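/- **Setting.** Fix $K\ge 1$ arms, a horizon $T\ge 0$, constants $b_0,\dots,b_{T-1}>0$ and $s_1,\dots,s_K\in\mathbb R$, a probability measure $\nu$ on $\mathbb R^K$ (the prior), and a policy $\pi=(\pi_t)_{t=0}^{T}$, i.e. Borel maps $\pi_t:(\mathbb R^K)^t\to\Delta_K$ into the probability simplex $\Delta_K$ that do not depend on $n$. *Batched experiment at scaling $n\in\mathbb N$.* Average rewards $h\sim\nu$ are drawn. Epoch $t=0,\dots,T-1$ has $b_tn$ units ($\lfloor b_tn\rfloor$ if $b_tn$ is not an integer). Unit $j$ of epoch $t$ has a vector of potential rewards $R^t_j=(R^t_{a,j})_{a}$, and $\xi^t_{a,j}\in\{0,1\}$ indicates whether arm $a$ is the one arm pulled for it. The scaled aggregate rewards are $$\sqrt n\,\bar R^n_{t,a}=\frac{1}{b_t\sqrt n}\sum_{j}\xi^t_{a,j}R^t_{a,j}.$$ Conditionally on $h$ and $\sqrt n\bar R^n_0,\dots,\sqrt n\bar R^n_{t-1}$: the pairs $(\xi^t_j,R^t_j)$ are independent over $j$; $\xi^t_j$ and $R^t_j$ are independent (ignorability); arm $a$ is pulled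 for unit $j$ with probability $\pi_{t,a}(\sqrt n\bar R^n_0,\dots,\sqrt n\bar R^n_{t-1})$ (sufficiency); and $R^t_j$ is distributed as $h/\sqrt n+\epsilon$. The law of the noise vector $\epsilon\in\mathbb R^K$ (which may depend on $n$ and $h$) satisfies $\mathbb E\,\epsilon_a=0$, $\operatorname{Var}(\epsilon_a)=s_a^2$ and $\mathbb E\|\epsilon\|_2^4\le C$, with $C$ independent of $n$ and $h$. Finally, given $h$ and all the $\sqrt n\bar R^n_t$, an arm $\hat a$ is drawn from $\pi_T(\sqrt n\bar R^n_0,\dots,\sqrt n\bar R^n_{T-1})$. *Gaussian sequential experiment.* $h\sim\nu$; for $t=0,\dots,T-1$, conditionally on $h,G_0,\dots,G_{t-1}$, $$G_t\sim N\Big(\big(\pi_{t,a}h_a\big)_{a},\ \operatorname{diag}\big(\pi_{t,a}s_a^2/b_t\big)_{a}\Big),\qquad \pi_{t}=\pi_{t}(G_0,\dots,G_{t-1});$$ and given $h,G_0,\dots,G_{T-1}$, an arm $\hat a$ is drawn from $\pi_T(G_0,\dots,G_{T-1})$. In either experiment the Bayes simple regret is $\mathrm{BSR}_T=\mathbb E\big[\max_a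 h_a-h_{\hat a}\big]$, the expectation being also over $h\sim\nu$. It is written $\mathrm{BSR}_T(\pi,\nu,\sqrt n\bar R^n)$ in the first and $\mathrm{BSR}_T(\pi,\nu,G)$ in the second. **Corollary.** Suppose that $\mathbb E_{h\sim\nu}\|h\|_1<\infty$ and that, for every $0\le t\le T$, the set of discontinuity points of $\pi_t$ has measure zero under the law of $(G_0,\dots,G_{t-1})$. Then $$\mathrm{BSR}_T(\pi,\nu,\sqrt n\bar R^n)\longrightarrow \mathrm{BSR}_T(\pi,\nu,G)\qquad (n\to\infty).$$ -/

import Mathlib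

open MeasureTheory ProbabilityTheory Filter Topology
open scoped ENNReal NNReal

noncomputable section

/-- An adaptive policy for `K` arms.  `prob t r` is the vector of sampling probabilities used after
observing the aggregate rewards `r 0, …, r (t - 1)`.  In an experiment with `T` epochs the epochs
`t < T` use `prob t`, the final selection uses `prob T`, and the later values play no role. -/
structure AdaptivePolicy (K : ℕ) where
  prob : (t : ℕ) → (Fin t → Fin K → ℝ) → Fin K → ℝ
  measurable_prob : ∀ t, Measurable (prob t)
  prob_mem : ∀ t r, prob t r ∈ stdSimplex ℝ (Fin K)

/-- The law on the arms that gives arm `a` the probability `p a`. -/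
def armLaw {K : ℕ} (p : Fin K → ℝ) : Measure (Fin K) :=
  ∑ a, ENNReal.ofReal (p a) • Measure.dirac a

/-- The observations of the epochs `0, …, t - 1`. -/
def history {K T : ℕ} {Ω : Type*} (obs : Fin T → Ω → Fin K → ℝ) (t : ℕ) (ht : t ≤ T) (ω : Ω) :
    Fin t → Fin K → ℝ :=
  fun i => obs (Fin.castLE ht i) ω

/-- The pair of the average rewards `h` and the observations of the epochs `0, …, t - 1`. -/
def past {K T : ℕ} {Ω : Type*} (h : Ω → Fin K → ℝ) (obs : Fin T → Ω → Fin K → ℝ)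
    (t : ℕ) (ht : t ≤ T) (ω : Ω) : (Fin K → ℝ) × (Fin t → Fin K → ℝ) :=
  (h ω, history obs t ht ω)

/-- Noise laws `Q n h` of the reward vector of one unit, at scaling `n` and average rewards `h`:
centered, with variance `s a ^ 2` for arm `a`, and with uniformly bounded fourth moment of the
Euclidean norm.  The noises of different arms may be dependent. -/
structure IsNoiseModel {K : ℕ} (s : Fin K → ℝ)
    (Q : ℕ → (Fin K → ℝ) → Measure (Fin K → ℝ)) : Prop where
  isProbabilityMeasure : ∀ n h, IsProbabilityMeasure (Q n h)
  mean_eq_zero : ∀ n h a, ∫ e, e a ∂(Q n h) = 0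
  variance_eq : ∀ n h a, Var[fun e => e a; Q n h] = s a ^ 2
  fourth_moment : ∃ C : ℝ≥0, ∀ n h,
    ∫⁻ e, ‖(WithLp.toLp 2 e : EuclideanSpace ℝ (Fin K))‖ₑ ^ 4 ∂(Q n h) ≤ C

/-- The number of units in epoch `t`; it is `b t * n` whenever this is an integer. -/
def batchSize {T : ℕ} (b : Fin T → ℝ) (n : ℕ) (t : Fin T) : ℕ := ⌊b t * n⌋₊

/-- The random variables of a batched experiment: the average rewards `h`, the arm pulled for
unit `j` of epoch `t`, the vector of potential rewards of this unit, and the arm selected at the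
end. -/
structure BatchedData (K T : ℕ) (b : Fin T → ℝ) (n : ℕ) (Ω : Type*) where
  h : Ω → Fin K → ℝ
  arm : (t : Fin T) → Fin (batchSize b n t) → Ω → Fin K
  reward : (t : Fin T) → Fin (batchSize b n t) → Ω → Fin K → ℝ
  choice : Ω → Fin K

/-- The scaled aggregate rewards `√n R̄ₜ`, whose coordinate `a` is
`(b t * √n)⁻¹ * ∑ j, ξ a j * R a j`, where `ξ a j` indicates that unit `j` pulled arm `a`. -/
def BatchedData.scaledMean {K T : ℕ} {b : Fin T → ℝ} {n : ℕ} {Ω : Type*}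
    (D : BatchedData K T b n Ω) (t : Fin T) (ω : Ω) (a : Fin K) : ℝ :=
  1 / (b t * √(n : ℝ)) *
    ∑ j, (if D.arm t j ω = a then (1 : ℝ) else 0) * D.reward t j ω a

/-- Given the average rewards and all observations, the final arm is drawn from `π.prob T`. -/
def IsFinalSelection {K T : ℕ} [NeZero K] {Ω : Type*} [MeasurableSpace Ω] (P : Measure Ω)
    [IsFiniteMeasure P] (π : AdaptivePolicy K) (h : Ω → Fin K → ℝ)
    (obs : Fin T → Ω → Fin K → ℝ) (choice : Ω → Fin K) : Prop :=
  ∀ᵐ x ∂(P.map (past h obs T le_rfl)),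
    condDistrib choice (past h obs T le_rfl) P x = armLaw (π.prob T x.2)

/-- The data `D` is a batched experiment, at scaling `n`, with prior `ν`, policy `π` and noise laws
`Q n`.  Conditional independence is expressed by regular conditional distributions, given the
average rewards and the scaled aggregate rewards of the earlier epochs. -/
structure IsBatchedExperiment {K T : ℕ} [NeZero K] {b : Fin T → ℝ} {n : ℕ} {Ω : Type*}
    [MeasurableSpace Ω] (P : Measure Ω) [IsProbabilityMeasure P]
    (ν : Measure (Fin K → ℝ)) (π : AdaptivePolicy K)
    (Q : ℕ → (Fin K → ℝ) → Measure (Fin K → ℝ)) (D : BatchedData K T b n Ω) : Prop where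
  measurable_h : Measurable D.h
  measurable_arm : ∀ t j, Measurable (D.arm t j)
  measurable_reward : ∀ t j, Measurable (D.reward t j)
  measurable_choice : Measurable D.choice
  /-- The average rewards are drawn from the prior. -/
  map_h : P.map D.h = ν
  /-- Different units of an epoch are conditionally independent. -/
  units_indep : ∀ t : Fin T, ∀ᵐ x ∂(P.map (past D.h D.scaledMean t t.isLt.le)),
    condDistrib (fun ω j => (D.arm t j ω, D.reward t j ω))
        (past D.h D.scaledMean t t.isLt.le) P x =
      Measure.pi fun j => condDistrib (fun ω => (D.arm t j ω, D.reward t j ω))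
        (past D.h D.scaledMean t t.isLt.le) P x
  /-- Ignorability: the pulled arm and the potential rewards of a unit are conditionally
  independent. -/
  ignorability : ∀ (t : Fin T) (j : Fin (batchSize b n t)),
    ∀ᵐ x ∂(P.map (past D.h D.scaledMean t t.isLt.le)),
      condDistrib (fun ω => (D.arm t j ω, D.reward t j ω))
          (past D.h D.scaledMean t t.isLt.le) P x =
        (condDistrib (D.arm t j) (past D.h D.scaledMean t t.isLt.le) P x).prod
          (condDistrib (D.reward t j) (past D.h D.scaledMean t t.isLt.le) P x)
  /-- Sufficiency: arms are drawn from the policy, evaluated at the scaled aggregate rewards. -/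
  arm_law : ∀ (t : Fin T) (j : Fin (batchSize b n t)),
    ∀ᵐ x ∂(P.map (past D.h D.scaledMean t t.isLt.le)),
      condDistrib (D.arm t j) (past D.h D.scaledMean t t.isLt.le) P x = armLaw (π.prob t x.2)
  /-- The potential rewards are distributed as `h / √n + ε`, where `ε` has the law `Q n h`. -/
  reward_law : ∀ (t : Fin T) (j : Fin (batchSize b n t)),
    ∀ᵐ x ∂(P.map (past D.h D.scaledMean t t.isLt.le)),
      condDistrib (D.reward t j) (past D.h D.scaledMean t t.isLt.le) P x =
        (Q n x.1).map fun e a => x.1 a / √(n : ℝ) + e a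
  /-- The final arm is drawn from the policy, evaluated at the scaled aggregate rewards. -/
  choice_law : IsFinalSelection P π D.h D.scaledMean D.choice

/-- The random variables of a Gaussian sequential experiment: the average rewards `h`, the
observations `G`, and the arm selected at the end. -/
structure GaussianData (K T : ℕ) (Ω : Type*) where
  h : Ω → Fin K → ℝ
  G : Fin T → Ω → Fin K → ℝ
  choice : Ω → Fin K

/-- The data `D` is a Gaussian sequential experiment with prior `ν` and policy `π`: given the
average rewards `h` and the earlier observations, `G t` is Gaussian with independent coordinates,
of mean `π t a * h a` and variance `π t a * s a ^ 2 / b t`. -/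
structure IsGaussianExperiment {K T : ℕ} [NeZero K] {Ω : Type*} [MeasurableSpace Ω]
    (P : Measure Ω) [IsProbabilityMeasure P] (b : Fin T → ℝ) (s : Fin K → ℝ)
    (ν : Measure (Fin K → ℝ)) (π : AdaptivePolicy K) (D : GaussianData K T Ω) : Prop where
  measurable_h : Measurable D.h
  measurable_G : ∀ t, Measurable (D.G t)
  measurable_choice : Measurable D.choice
  map_h : P.map D.h = ν
  G_law : ∀ t : Fin T, ∀ᵐ x ∂(P.map (past D.h D.G t t.isLt.le)),
    condDistrib (D.G t) (past D.h D.G t t.isLt.le) P x =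
      Measure.pi fun a => gaussianReal (π.prob t x.2 a * x.1 a)
        (Real.toNNReal (π.prob t x.2 a * s a ^ 2 / b t))
  choice_law : IsFinalSelection P π D.h D.G D.choice

/-- The Bayes simple regret: the expected gap between the best average reward and the average
reward of the selected arm, the average rewards being random. -/
def bayesSimpleRegret {K : ℕ} {Ω : Type*} [MeasurableSpace Ω] (P : Measure Ω)
    (h : Ω → Fin K → ℝ) (choice : Ω → Fin K) : ℝ :=
  ∫ ω, ((⨆ a, h ω a) - h ω (choice ω)) ∂P

end

/-! The heart is weak convergence of the joint law of `h` and the first `t` observations, by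
induction on `t` (`tendsto_pastLaw`). At `t = 0` this law is that of `h`, the same for all `n`. For
the inductive step, Lévy's theorem reduces to characteristic functions. Given the past, the units of
an epoch are i.i.d., so the aggregate has conditional characteristic function `φ ^ m`, with `m ≈ βn`
and `φ = 1 + z / (βn) + O(n ^ (-3/2))`, where `exp z` is the Gaussian counterpart. Hence `φ ^ m` is
within `S h / √n` of `exp z`, uniformly in the sampling probabilities
(`IsNoiseModel.exists_norm_pow_sub_cexp_le`). The error depends on the past only through `h`, whose
law does not vary with `n`, so capping it at 2 and dominated convergence remove it. What remains is
the integral, against the law of the past, of a bounded function that is continuous wherever the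
policy is; the induction hypothesis and the mapping theorem for a.e. continuous functions give its
limit. For the regret, the expected maximum is common to both experiments. The expected reward of
the selected arm, truncated at level `N`, is the integral against the law of the full past of a
bounded function, a.e. continuous under the limit law; integrability of the prior makes the
truncation error small uniformly in `n`. -/

/-! ### Elementary estimates for the complex exponential. -/

/-- For `|x| > 1` the cube dominates every term separately. A bound valid for all `x` can be
integrated without splitting the range of the random variable. -/
lemma norm_cexp_mul_I_sub_taylor_le (x : ℝ) :
    ‖Complex.exp (x * Complex.I) - (1 + x * Complex.I - x ^ 2 / 2)‖ ≤ 4 * |x| ^ 3 := by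
  rcases le_or_gt |x| 1 with h | h
  · have hn : ‖(x : ℂ) * Complex.I‖ = |x| := by simp
    have h3 := Complex.exp_bound (x := x * Complex.I) (by rw [hn]; exact h) (n := 3) (by norm_num)
    rw [hn] at h3
    have e : ∑ m ∈ Finset.range 3, ((x : ℂ) * Complex.I) ^ m / (m.factorial : ℂ)
        = 1 + x * Complex.I - x ^ 2 / 2 := by
      simp only [Finset.sum_range_succ, Finset.sum_range_zero]
      norm_num [mul_pow, Nat.factorial]
      ring
    rw [e] at h3
    refine h3.trans ?_
    rw [mul_comm]
    gcongr
    norm_num [Nat.factorial]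
  · have h1 : ‖Complex.exp (x * Complex.I)‖ = 1 := Complex.norm_exp_ofReal_mul_I x
    have h2 : ‖(1 + x * Complex.I - x ^ 2 / 2 : ℂ)‖ ≤ 1 + |x| + |x| ^ 2 / 2 := by
      refine (norm_sub_le _ _).trans ?_
      refine add_le_add ((norm_add_le _ _).trans (by simp)) (by simp)
    refine (norm_sub_le _ _).trans ?_
    rw [h1]
    nlinarith [mul_pos (sub_pos.2 h) (sub_pos.2 h), sq_nonneg |x|,
      mul_pos (pow_pos (zero_lt_one.trans h) 2) (sub_pos.2 h)]

lemma norm_cexp_le_one {z : ℂ} (hz : z.re ≤ 0) : ‖Complex.exp z‖ ≤ 1 := by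
  rw [Complex.norm_exp]; exact Real.exp_le_one_iff.2 hz

/-- On the left half-plane `exp` is bounded by 1, so the usual estimate near 0 extends to large `z`
at the price of a constant. -/
lemma norm_cexp_sub_one_sub_id_le_of_re_nonpos {z : ℂ} (hz : z.re ≤ 0) :
    ‖Complex.exp z - 1 - z‖ ≤ 3 * ‖z‖ ^ 2 := by
  rcases le_or_gt ‖z‖ 1 with h | h
  · exact (Complex.norm_exp_sub_one_sub_id_le h).trans (by nlinarith [sq_nonneg ‖z‖])
  · have := norm_cexp_le_one hz
    calc ‖Complex.exp z - 1 - z‖ ≤ ‖Complex.exp z‖ + ‖(1 : ℂ)‖ + ‖z‖ :=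
          (norm_sub_le _ _).trans (by gcongr; exact norm_sub_le _ _)
      _ ≤ 1 + 1 + ‖z‖ := by gcongr; simp
      _ ≤ _ := by nlinarith

lemma norm_cexp_sub_one_le_of_re_nonpos {z : ℂ} (hz : z.re ≤ 0) :
    ‖Complex.exp z - 1‖ ≤ 2 * ‖z‖ := by
  rcases le_or_gt ‖z‖ 1 with h | h
  · exact Complex.norm_exp_sub_one_le h
  · have := norm_cexp_le_one hz
    calc ‖Complex.exp z - 1‖ ≤ ‖Complex.exp z‖ + ‖(1 : ℂ)‖ := norm_sub_le _ _
      _ ≤ 1 + 1 := by gcongr; simp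
      _ ≤ _ := by linarith

/-- Telescoping: inside the unit disc, one-step errors add up and are not amplified. -/
lemma norm_pow_sub_pow_le_mul {z w : ℂ} (hz : ‖z‖ ≤ 1) (hw : ‖w‖ ≤ 1) (m : ℕ) :
    ‖z ^ m - w ^ m‖ ≤ m * ‖z - w‖ := by
  induction m with
  | zero => simp
  | succ m ih =>
    have e : z ^ (m + 1) - w ^ (m + 1) = z ^ m * (z - w) + (z ^ m - w ^ m) * w := by ring
    rw [e]
    refine (norm_add_le _ _).trans ?_
    rw [norm_mul, norm_mul, norm_pow]
    have h1 : ‖z‖ ^ m * ‖z - w‖ ≤ 1 * ‖z - w‖ := by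
      gcongr; exact pow_le_one₀ (norm_nonneg _) hz
    have h2 : ‖z ^ m - w ^ m‖ * ‖w‖ ≤ (m * ‖z - w‖) * 1 := by gcongr
    push_cast
    linarith

/-! ### Weak convergence and conditional laws. -/

/-- The continuous mapping theorem for a map that is almost everywhere continuous. -/
lemma tendsto_map_of_ae_continuousAt {X Y ι : Type*} [TopologicalSpace X] [MeasurableSpace X]
    [OpensMeasurableSpace X] [HasOuterApproxClosed X] [TopologicalSpace Y] [MeasurableSpace Y]
    [OpensMeasurableSpace Y] {L : Filter ι} [L.IsCountablyGenerated]
    {μs : ι → ProbabilityMeasure X} {μ : ProbabilityMeasure X} (hμ : Tendsto μs L (𝓝 μ))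
    {g : X → Y} (hg : Measurable g) (hgc : ∀ᵐ x ∂(μ : Measure X), ContinuousAt g x) :
    Tendsto (fun i => (μs i).map hg.aemeasurable) L (𝓝 (μ.map hg.aemeasurable)) := by
  refine tendsto_of_forall_isClosed_limsup_le' fun F hF => ?_
  have hF' : MeasurableSet F := hF.measurableSet
  simp only [ProbabilityMeasure.toMeasure_map, Measure.map_apply hg hF']
  calc limsup (fun i => (μs i : Measure X) (g ⁻¹' F)) L
      ≤ limsup (fun i => (μs i : Measure X) (closure (g ⁻¹' F))) L :=
        limsup_le_limsup (Eventually.of_forall fun i => measure_mono subset_closure)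
    _ ≤ (μ : Measure X) (closure (g ⁻¹' F)) :=
        ProbabilityMeasure.limsup_measure_closed_le_of_tendsto hμ isClosed_closure
    _ ≤ (μ : Measure X) (g ⁻¹' F) := by
        -- A point of the closure of `g ⁻¹' F` at which `g` is continuous is mapped into the closure
        -- of `F`, which is `F`.
        refine measure_mono_ae ?_
        filter_upwards [hgc] with x hx hxc
        have h1 : g x ∈ closure (g '' (g ⁻¹' F)) := hx.continuousWithinAt.mem_closure_image hxc
        exact hF.closure_subset_iff.2 (Set.image_preimage_subset g F) h1

/-- Weak convergence implies convergence of the integrals of a bounded measurable function that is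
almost everywhere continuous. -/
lemma tendsto_integral_of_ae_continuousAt {X ι : Type*} [TopologicalSpace X] [MeasurableSpace X]
    [OpensMeasurableSpace X] [HasOuterApproxClosed X] {L : Filter ι} [L.IsCountablyGenerated]
    {μs : ι → ProbabilityMeasure X} {μ : ProbabilityMeasure X} (hμ : Tendsto μs L (𝓝 μ))
    {g : X → ℂ} (hg : Measurable g) (hgc : ∀ᵐ x ∂(μ : Measure X), ContinuousAt g x)
    {C : ℝ} (hC : ∀ x, ‖g x‖ ≤ C) :
    Tendsto (fun i => ∫ x, g x ∂(μs i : Measure X)) L (𝓝 (∫ x, g x ∂(μ : Measure X))) := by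
  have hmem : ∀ x, g x ∈ Metric.closedBall (0 : ℂ) C := fun x => by simpa using hC x
  -- With values in a compact ball, the inclusion into `ℂ` is itself a bounded continuous test
  -- function for the image laws.
  let g' : X → Metric.closedBall (0 : ℂ) C := fun x => ⟨g x, hmem x⟩
  have hg' : Measurable g' := hg.subtype_mk
  have hc' : ∀ᵐ x ∂(μ : Measure X), ContinuousAt g' x := by
    filter_upwards [hgc] with x hx
    exact Topology.IsInducing.subtypeVal.continuousAt_iff.2 hx
  have h := tendsto_map_of_ae_continuousAt hμ hg' hc'
  rw [ProbabilityMeasure.tendsto_iff_forall_integral_rclike_tendsto ℂ] at h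
  have := h (BoundedContinuousFunction.mkOfCompact ⟨Subtype.val, continuous_subtype_val⟩)
  simp only [ProbabilityMeasure.toMeasure_map, BoundedContinuousFunction.mkOfCompact_apply,
    ContinuousMap.coe_mk] at this
  have e : ∀ ρ : Measure X, ∫ y, (y : ℂ) ∂(ρ.map g') = ∫ x, g x ∂ρ := fun ρ =>
    integral_map hg'.aemeasurable continuous_subtype_val.measurable.aestronglyMeasurable
  simpa only [e] using this

/-- Lévy's convergence theorem on a finite-dimensional normed space, in terms of functionals. -/
lemma tendsto_of_tendsto_integral_cexp {E : Type*} [NormedAddCommGroup E] [NormedSpace ℝ E]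
    [FiniteDimensional ℝ E] [MeasurableSpace E] [BorelSpace E]
    {μs : ℕ → ProbabilityMeasure E} {μ : ProbabilityMeasure E}
    (h : ∀ l : E →L[ℝ] ℝ, Tendsto (fun n => ∫ x, Complex.exp (l x * Complex.I) ∂(μs n : Measure E))
      atTop (𝓝 (∫ x, Complex.exp (l x * Complex.I) ∂(μ : Measure E)))) :
    Tendsto μs atTop (𝓝 μ) := by
  -- Characteristic functions need an inner product, so the laws are transported to a Euclidean
  -- space by a linear homeomorphism and back.
  let e := toEuclidean (E := E)
  have he : Measurable e := e.continuous.measurable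
  have hes : Measurable e.symm := e.symm.continuous.measurable
  have key : Tendsto (fun n => (μs n).map he.aemeasurable) atTop (𝓝 (μ.map he.aemeasurable)) := by
    refine ProbabilityMeasure.tendsto_of_tendsto_charFun fun t => ?_
    have e1 : ∀ ρ : Measure E, charFun (ρ.map e) t
        = ∫ x, Complex.exp (((innerSL ℝ t).comp (e : E →L[ℝ] _)) x * Complex.I) ∂ρ := by
      intro ρ
      rw [charFun_apply, integral_map he.aemeasurable (by fun_prop)]
      simp [real_inner_comm]
    simp only [ProbabilityMeasure.toMeasure_map, e1]
    exact h _
  have h2 := ProbabilityMeasure.tendsto_map_of_tendsto_of_continuous _ _ key e.symm.continuous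
  have e2 : ∀ ρ : ProbabilityMeasure E, (ρ.map he.aemeasurable).map
      e.symm.continuous.measurable.aemeasurable = ρ := by
    intro ρ
    apply Subtype.ext
    change ((ρ : Measure E).map e).map e.symm = ρ
    rw [Measure.map_map hes he]
    simp
  simpa only [e2] using h2

/-- The tower property with `f (X)` taken out. It turns the hypotheses on conditional laws into
identities between integrals. -/
lemma integral_mul_comp_condDistrib {Ω α β : Type*} [MeasurableSpace Ω] [MeasurableSpace α]
    [MeasurableSpace β] [StandardBorelSpace β] [Nonempty β] (P : Measure Ω) [IsFiniteMeasure P]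
    {X : Ω → α} {Y : Ω → β} (hX : Measurable X) (hY : Measurable Y) {f : α → ℂ} {g : β → ℂ}
    (hf : Measurable f) (hg : Measurable g) {C : ℝ} (hfC : ∀ x, ‖f x‖ ≤ C)
    (hg1 : ∀ y, ‖g y‖ ≤ 1) :
    ∫ ω, f (X ω) * g (Y ω) ∂P = ∫ x, f x * ∫ y, g y ∂(condDistrib Y X P x) ∂(P.map X) := by
  have hF : Measurable fun z : α × β => f z.1 * g z.2 :=
    (hf.comp measurable_fst).mul (hg.comp measurable_snd)
  have e := integral_map (hX.prodMk hY).aemeasurable (hF.aestronglyMeasurable (μ := P.map _))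
  rw [← e, ← compProd_map_condDistrib hY.aemeasurable, Measure.integral_compProd]
  · simp only [integral_const_mul]
  · refine Integrable.of_bound hF.aestronglyMeasurable C (Eventually.of_forall fun z => ?_)
    rw [norm_mul]
    exact (mul_le_of_le_one_right (norm_nonneg _) (hg1 _)).trans (hfC _)

/-! ### Moments and second-order expansion of characteristic functions. -/

lemma integrable_and_sq_of_abs_cube {Ω : Type*} [MeasurableSpace Ω] {P : Measure Ω}
    [IsFiniteMeasure P] {X : Ω → ℝ} (hX : Measurable X)
    (h3 : Integrable (fun ω => |X ω| ^ 3) P) :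
    Integrable X P ∧ Integrable (fun ω => X ω ^ 2) P := by
  have hb : Integrable (fun ω => 1 + |X ω| ^ 3) P := (integrable_const 1).add h3
  constructor
  · refine hb.mono' hX.aestronglyMeasurable (Eventually.of_forall fun ω => ?_)
    rw [Real.norm_eq_abs]
    have := abs_nonneg (X ω)
    rcases le_total |X ω| 1 with h | h
    · have := pow_nonneg this 3; linarith
    · have := pow_le_pow_right₀ h (show 1 ≤ 3 by norm_num); simp only [pow_one] at this; linarith
  · refine hb.mono' (hX.pow_const 2).aestronglyMeasurable (Eventually.of_forall fun ω => ?_)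
    rw [Real.norm_eq_abs, abs_pow]
    have := abs_nonneg (X ω)
    rcases le_total |X ω| 1 with h | h
    · have h3 := pow_nonneg this 3; have := pow_le_one₀ (n := 2) this h; linarith
    · have := pow_le_pow_right₀ h (show 2 ≤ 3 by norm_num); linarith

lemma norm_integral_cexp_sub_le {Ω : Type*} [MeasurableSpace Ω] (P : Measure Ω)
    [IsProbabilityMeasure P] {X : Ω → ℝ} (hX : Measurable X)
    (h3 : Integrable (fun ω => |X ω| ^ 3) P) :
    ‖∫ ω, Complex.exp (X ω * Complex.I) ∂P
        - (1 + (∫ ω, X ω ∂P : ℝ) * Complex.I - (∫ ω, X ω ^ 2 ∂P : ℝ) / 2)‖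
      ≤ 4 * ∫ ω, |X ω| ^ 3 ∂P := by
  obtain ⟨h1, h2⟩ := integrable_and_sq_of_abs_cube hX h3
  have hexp : Integrable (fun ω => Complex.exp (X ω * Complex.I)) P := by
    refine Integrable.of_bound (by fun_prop) 1 (Eventually.of_forall fun ω => ?_)
    rw [Complex.norm_exp_ofReal_mul_I]
  have hpoly : ∫ ω, (1 + (X ω : ℂ) * Complex.I - (X ω : ℂ) ^ 2 / 2) ∂P
      = 1 + (∫ ω, X ω ∂P : ℝ) * Complex.I - (∫ ω, X ω ^ 2 ∂P : ℝ) / 2 := by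
    have h1c : Integrable (fun ω => (X ω : ℂ) * Complex.I) P := h1.ofReal.mul_const _
    have h2c : Integrable (fun ω => (X ω : ℂ) ^ 2 / 2) P := by
      have := (h2.ofReal (𝕜 := ℂ)).div_const 2
      simpa using this
    have h01 : Integrable (fun ω => 1 + (X ω : ℂ) * Complex.I) P := (integrable_const 1).add h1c
    rw [integral_sub h01 h2c, integral_add (integrable_const 1) h1c,
      integral_mul_const, integral_div, integral_const, ← integral_complex_ofReal,
      ← integral_complex_ofReal]
    simp
  have hpi : Integrable (fun ω => 1 + (X ω : ℂ) * Complex.I - (X ω : ℂ) ^ 2 / 2) P := by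
    have h2c := (h2.ofReal (𝕜 := ℂ)).div_const 2
    refine ((integrable_const 1).add (h1.ofReal.mul_const _)).sub ?_
    simpa using h2c
  rw [← hpoly, ← integral_sub hexp hpi, ← integral_const_mul]
  exact norm_integral_le_of_norm_le (h3.const_mul 4)
    (Eventually.of_forall fun ω => norm_cexp_mul_I_sub_taylor_le (X ω))

/-- Follows from `|x| ^ 3 ≤ 1 + |x| ^ 4` in each coordinate. What matters is that `M` serves all
`n`, `h` and `a` at once. -/
lemma IsNoiseModel.exists_third_moment {K : ℕ} {s : Fin K → ℝ}
    {Q : ℕ → (Fin K → ℝ) → Measure (Fin K → ℝ)} (hQ : IsNoiseModel s Q) :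
    ∃ M : ℝ, 0 ≤ M ∧ ∀ n h a, Integrable (fun e : Fin K → ℝ => |e a| ^ 3) (Q n h) ∧
      ∫ e, |e a| ^ 3 ∂(Q n h) ≤ M := by
  obtain ⟨C, hC⟩ := hQ.fourth_moment
  refine ⟨1 + C, by positivity, fun n h a => ?_⟩
  have := hQ.isProbabilityMeasure n h
  have hle : ∫⁻ e : Fin K → ℝ, ENNReal.ofReal (|e a| ^ 4) ∂(Q n h) ≤ C := by
    refine (lintegral_mono fun e => ?_).trans (hC n h)
    rw [ENNReal.ofReal_pow (abs_nonneg _), ← Real.enorm_eq_ofReal_abs]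
    gcongr
    rw [← ofReal_norm, ← ofReal_norm]
    exact ENNReal.ofReal_le_ofReal
      (PiLp.norm_apply_le (WithLp.toLp 2 e : EuclideanSpace ℝ (Fin K)) a)
  have hm : Measurable fun e : Fin K → ℝ => |e a| := by fun_prop
  have h4 : Integrable (fun e : Fin K → ℝ => |e a| ^ 4) (Q n h) := by
    refine (lintegral_ofReal_ne_top_iff_integrable (hm.pow_const 4).aestronglyMeasurable
      (Eventually.of_forall fun e => by positivity)).1 ?_
    exact (hle.trans_lt ENNReal.coe_lt_top).ne
  have h4' : ∫ e, |e a| ^ 4 ∂(Q n h) ≤ C := by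
    rw [integral_eq_lintegral_of_nonneg_ae (Eventually.of_forall fun e => by positivity)
      (hm.pow_const 4).aestronglyMeasurable]
    exact ENNReal.toReal_le_coe_of_le_coe hle
  have hpt : ∀ e : Fin K → ℝ, |e a| ^ 3 ≤ 1 + |e a| ^ 4 := fun e => by
    rcases le_total |e a| 1 with h | h
    · have h4 := pow_nonneg (abs_nonneg (e a)) 4
      have := pow_le_one₀ (n := 3) (abs_nonneg (e a)) h
      linarith
    · have := pow_le_pow_right₀ h (show 3 ≤ 4 by norm_num); linarith
  have h3 : Integrable (fun e : Fin K → ℝ => |e a| ^ 3) (Q n h) := by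
    refine ((integrable_const 1).add h4).mono' (hm.pow_const 3).aestronglyMeasurable
      (Eventually.of_forall fun e => ?_)
    rw [Real.norm_of_nonneg (by positivity)]
    exact hpt e
  refine ⟨h3, (integral_mono h3 ((integrable_const 1).add h4) hpt).trans ?_⟩
  simp only [Pi.add_apply]
  rw [integral_add (integrable_const 1) h4]
  simpa using h4'

/-- Expansion of the characteristic function of the scaled reward of a pulled arm. -/
lemma norm_integral_cexp_shift_sub_le {K : ℕ} (P : Measure (Fin K → ℝ)) [IsProbabilityMeasure P]
    (a : Fin K) {σ M : ℝ} (hmean : ∫ e, e a ∂P = 0) (hvar : Var[fun e => e a; P] = σ ^ 2)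
    (h3 : Integrable (fun e : Fin K → ℝ => |e a| ^ 3) P) (hM : ∫ e, |e a| ^ 3 ∂P ≤ M)
    {ε : ℝ} (hε0 : 0 ≤ ε) (hε1 : ε ≤ 1) (w h : ℝ) :
    ‖∫ e, Complex.exp (((ε * w * (ε * h + e a) : ℝ) : ℂ) * Complex.I) ∂P
        - 1 - (ε ^ 2 : ℝ) * (w * h * Complex.I - w ^ 2 * σ ^ 2 / 2)‖
      ≤ ε ^ 3 * (w ^ 2 * h ^ 2 + 16 * |w| ^ 3 * (|h| ^ 3 + M)) := by
  have hm : Measurable fun e : Fin K → ℝ => e a := by fun_prop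
  obtain ⟨h1, h2⟩ := integrable_and_sq_of_abs_cube hm h3
  have hsq : ∫ e, e a ^ 2 ∂P = σ ^ 2 := by
    rw [← hvar, variance_of_integral_eq_zero hm.aemeasurable hmean]
  let X : (Fin K → ℝ) → ℝ := fun e => ε * w * (ε * h + e a)
  have hX : Measurable X := by fun_prop
  have eX : ∫ e, X e ∂P = ε ^ 2 * (w * h) := by
    simp only [X]
    rw [integral_const_mul, integral_add (integrable_const _) h1, hmean]
    simp; ring
  have eX2 : ∫ e, X e ^ 2 ∂P = ε ^ 2 * w ^ 2 * (ε ^ 2 * h ^ 2 + σ ^ 2) := by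
    have : ∀ e : Fin K → ℝ, X e ^ 2
        = ε ^ 2 * w ^ 2 * (ε ^ 2 * h ^ 2 + 2 * ε * h * e a + e a ^ 2) := fun e => by
      simp only [X]; ring
    simp only [this]
    have h01 : Integrable (fun e : Fin K → ℝ => ε ^ 2 * h ^ 2 + 2 * ε * h * e a) P :=
      (integrable_const _).add (h1.const_mul _)
    rw [integral_const_mul, integral_add h01 h2,
      integral_add (integrable_const _) (h1.const_mul _), integral_const_mul (2 * ε * h), hmean, hsq]
    simp
  -- Here `(x + y) ^ 3 ≤ 4 * (x ^ 3 + y ^ 3)`; with the Taylor constant 4 this produces the 16 of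
  -- the statement.
  have hX3 : ∀ e, |X e| ^ 3 ≤ ε ^ 3 * |w| ^ 3 * (4 * (|h| ^ 3 + |e a| ^ 3)) := fun e => by
    simp only [X, abs_mul, mul_pow, abs_of_nonneg hε0]
    gcongr
    have : |ε * h + e a| ≤ |h| + |e a| := by
      refine (abs_add_le _ _).trans ?_
      rw [abs_mul, abs_of_nonneg hε0]
      have := mul_le_mul_of_nonneg_right hε1 (abs_nonneg h)
      linarith
    refine (pow_le_pow_left₀ (abs_nonneg _) this 3).trans ?_
    have h0 := abs_nonneg h
    have h1 := abs_nonneg (e a)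
    nlinarith [mul_nonneg (add_nonneg h0 h1) (sq_nonneg (|h| - |e a|))]
  have hb3 : Integrable (fun e : Fin K → ℝ => ε ^ 3 * |w| ^ 3 * (4 * (|h| ^ 3 + |e a| ^ 3))) P :=
    (((integrable_const _).add h3).const_mul 4).const_mul _
  have iX3 : Integrable (fun e => |X e| ^ 3) P := by
    refine hb3.mono' ((hX.norm.pow_const 3)).aestronglyMeasurable (Eventually.of_forall fun e => ?_)
    rw [Real.norm_of_nonneg (by positivity)]
    exact hX3 e
  have bX3 : ∫ e, |X e| ^ 3 ∂P ≤ ε ^ 3 * |w| ^ 3 * (4 * (|h| ^ 3 + M)) := by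
    refine (integral_mono iX3 hb3 hX3).trans ?_
    rw [integral_const_mul, integral_const_mul, integral_add (integrable_const _) h3]
    have : ∫ _e : Fin K → ℝ, |h| ^ 3 ∂P = |h| ^ 3 := by simp
    rw [this]
    gcongr
  have key := norm_integral_cexp_sub_le P hX iX3
  rw [eX, eX2] at key
  -- The expansion involves the second moment and not the variance; the extra squared mean is of
  -- order `ε ^ 4`, absorbed since `ε ≤ 1`.
  have e1 : ∫ e, Complex.exp ((X e : ℂ) * Complex.I) ∂P
        - 1 - (ε ^ 2 : ℝ) * (w * h * Complex.I - w ^ 2 * σ ^ 2 / 2)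
      = (∫ e, Complex.exp ((X e : ℂ) * Complex.I) ∂P - (1 + (ε ^ 2 * (w * h) : ℝ) * Complex.I
        - (ε ^ 2 * w ^ 2 * (ε ^ 2 * h ^ 2 + σ ^ 2) : ℝ) / 2))
        + (-(ε ^ 4 * w ^ 2 * h ^ 2 / 2) : ℝ) := by
    push_cast; ring
  change ‖∫ e, Complex.exp ((X e : ℂ) * Complex.I) ∂P
        - 1 - (ε ^ 2 : ℝ) * (w * h * Complex.I - w ^ 2 * σ ^ 2 / 2)‖ ≤ _
  rw [e1]
  refine (norm_add_le _ _).trans ?_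
  have e2 : ‖((-(ε ^ 4 * w ^ 2 * h ^ 2 / 2) : ℝ) : ℂ)‖ ≤ ε ^ 3 * (w ^ 2 * h ^ 2) := by
    rw [Complex.norm_real, norm_neg, Real.norm_of_nonneg (by positivity)]
    have h4 : ε ^ 4 ≤ ε ^ 3 := pow_le_pow_of_le_one hε0 hε1 (by norm_num)
    have h5 : ε ^ 4 * (w ^ 2 * h ^ 2) ≤ ε ^ 3 * (w ^ 2 * h ^ 2) := by gcongr
    have h6 : 0 ≤ ε ^ 4 * (w ^ 2 * h ^ 2) := by positivity
    nlinarith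
  nlinarith

/-! ### The conditional characteristic function of one epoch. -/

/-- The exponent of the limiting conditional characteristic function of one epoch. -/
noncomputable def gaussExponent {K : ℕ} (β : ℝ) (s u h p : Fin K → ℝ) : ℂ :=
  ∑ a, (p a : ℂ) * (u a * h a * Complex.I - u a ^ 2 * s a ^ 2 / (2 * β))

/-- The real part is minus half the variance of the functional `u` of the Gaussian observation. -/
lemma gaussExponent_re_nonpos {K : ℕ} {β : ℝ} (hβ : 0 < β) (s u h : Fin K → ℝ) {p : Fin K → ℝ}
    (hp : p ∈ stdSimplex ℝ (Fin K)) : (gaussExponent β s u h p).re ≤ 0 := by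
  rw [gaussExponent, Complex.re_sum]
  refine Finset.sum_nonpos fun a _ => ?_
  have : ((p a : ℂ) * (u a * h a * Complex.I - u a ^ 2 * s a ^ 2 / (2 * β))).re
      = -(p a * (u a ^ 2 * s a ^ 2 / (2 * β))) := by
    have e : ((p a : ℂ) * (u a * h a * Complex.I - u a ^ 2 * s a ^ 2 / (2 * β)))
      = ((-(p a * (u a ^ 2 * s a ^ 2 / (2 * β))) : ℝ) : ℂ)
        + ((p a * (u a * h a) : ℝ) : ℂ) * Complex.I := by push_cast; ring
    rw [e]; simp [-Complex.ofReal_neg, -Complex.ofReal_mul, -Complex.ofReal_div, Complex.ofReal_re]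
  rw [this, neg_nonpos]
  have := hp.1 a
  positivity

/-- Since `p a ≤ 1`, the bound is free of `p`; this is what makes the later error uniform over
policies. -/
lemma norm_gaussExponent_le {K : ℕ} (β : ℝ) (s u h : Fin K → ℝ) {p : Fin K → ℝ}
    (hp : p ∈ stdSimplex ℝ (Fin K)) :
    ‖gaussExponent β s u h p‖
      ≤ ∑ a, ‖(u a * h a * Complex.I - u a ^ 2 * s a ^ 2 / (2 * β) : ℂ)‖ := by
  refine (norm_sum_le _ _).trans (Finset.sum_le_sum fun a _ => ?_)
  rw [norm_mul, Complex.norm_real, Real.norm_of_nonneg (hp.1 a)]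
  exact mul_le_of_le_one_left (norm_nonneg _) (mem_Icc_of_mem_stdSimplex hp a).2

/-- A power of a complex number close to `1 + δ z`, with exponent close to `1 / δ`, is close
to `exp z`. -/
lemma norm_pow_sub_cexp_le {φ z : ℂ} (hφ : ‖φ‖ ≤ 1) (hz : z.re ≤ 0) {δ : ℝ} (hδ : 0 ≤ δ) {m : ℕ}
    (hm : m * δ ≤ 1) (hm' : 1 ≤ m * δ + δ) :
    ‖φ ^ m - Complex.exp z‖ ≤ m * (‖φ - 1 - δ * z‖ + 3 * δ ^ 2 * ‖z‖ ^ 2) + 2 * δ * ‖z‖ := by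
  have hre : ((δ : ℂ) * z).re ≤ 0 := by
    rw [Complex.re_ofReal_mul]; exact mul_nonpos_of_nonneg_of_nonpos hδ hz
  have h1 := norm_pow_sub_pow_le_mul hφ (norm_cexp_le_one hre) m
  have h2 : ‖φ - Complex.exp (δ * z)‖ ≤ ‖φ - 1 - δ * z‖ + 3 * δ ^ 2 * ‖z‖ ^ 2 := by
    have e : φ - Complex.exp (δ * z) = (φ - 1 - δ * z) - (Complex.exp (δ * z) - 1 - δ * z) := by
      ring
    rw [e]
    refine (norm_sub_le _ _).trans (add_le_add le_rfl ?_)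
    refine (norm_cexp_sub_one_sub_id_le_of_re_nonpos hre).trans (le_of_eq ?_)
    rw [norm_mul, Complex.norm_real, Real.norm_of_nonneg hδ]; ring
  -- The rounding of the batch size leaves `1 - m * δ` in `[0, δ]`, and the missing factor `exp ((1
  -- - m * δ) * z)` is close to 1.
  have h3 : ‖Complex.exp (δ * z) ^ m - Complex.exp z‖ ≤ 2 * δ * ‖z‖ := by
    have e : Complex.exp (δ * z) ^ m - Complex.exp z
        = -(Complex.exp ((m * δ : ℝ) * z) * (Complex.exp ((1 - m * δ : ℝ) * z) - 1)) := by
      rw [← Complex.exp_nat_mul, mul_sub, ← Complex.exp_add]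
      push_cast
      ring_nf
    have hr1 : (((m * δ : ℝ) : ℂ) * z).re ≤ 0 := by
      rw [Complex.re_ofReal_mul]; exact mul_nonpos_of_nonneg_of_nonpos (by positivity) hz
    have hr2 : (((1 - m * δ : ℝ) : ℂ) * z).re ≤ 0 := by
      rw [Complex.re_ofReal_mul]; exact mul_nonpos_of_nonneg_of_nonpos (by linarith) hz
    rw [e, norm_neg, norm_mul]
    have h4 := norm_cexp_sub_one_le_of_re_nonpos hr2
    rw [norm_mul, Complex.norm_real, Real.norm_of_nonneg (by linarith : 0 ≤ 1 - m * δ)] at h4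
    calc _ ≤ 1 * (2 * ((1 - m * δ) * ‖z‖)) := by
          gcongr; exact norm_cexp_le_one hr1
      _ ≤ 1 * (2 * (δ * ‖z‖)) := by gcongr; linarith
      _ = _ := by ring
  have e : φ ^ m - Complex.exp z
      = (φ ^ m - Complex.exp (δ * z) ^ m) + (Complex.exp (δ * z) ^ m - Complex.exp z) := by ring
  rw [e]
  refine (norm_add_le _ _).trans (add_le_add (h1.trans ?_) h3)
  gcongr

lemma integral_armLaw {K : ℕ} {p : Fin K → ℝ} (hp : ∀ a, 0 ≤ p a) (f : Fin K → ℂ) :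
    ∫ a, f a ∂(armLaw p) = ∑ a, (p a : ℂ) * f a := by
  rw [armLaw, integral_finsetSum_measure]
  · refine Finset.sum_congr rfl fun a _ => ?_
    rw [integral_smul_measure, integral_dirac, ENNReal.toReal_ofReal (hp a), Complex.real_smul]
  · exact fun a _ => Integrable.of_finite.smul_measure ENNReal.ofReal_ne_top

lemma isProbabilityMeasure_armLaw {K : ℕ} {p : Fin K → ℝ} (hp : p ∈ stdSimplex ℝ (Fin K)) :
    IsProbabilityMeasure (armLaw p) := by
  refine ⟨?_⟩
  simp only [armLaw, Measure.coe_finsetSum, Finset.sum_apply, Measure.smul_apply, measure_univ,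
    smul_eq_mul, mul_one]
  rw [← ENNReal.ofReal_sum_of_nonneg fun a _ => hp.1 a, hp.2, ENNReal.ofReal_one]

/-- The contribution of a unit to the linear functional `u` of the aggregate rewards. -/
noncomputable def unitScore {K : ℕ} (u : Fin K → ℝ) (y : Fin K × (Fin K → ℝ)) : ℝ :=
  ∑ a, u a * ((if y.1 = a then 1 else 0) * y.2 a)

lemma measurable_unitScore {K : ℕ} (u : Fin K → ℝ) : Measurable (unitScore u) := by
  unfold unitScore
  refine Finset.measurable_sum _ fun a _ => ?_
  have h1 : Measurable fun y : Fin K × (Fin K → ℝ) => if y.1 = a then (1 : ℝ) else 0 :=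
    (Measurable.of_discrete (f := fun i : Fin K => if i = a then (1 : ℝ) else 0)).comp
      measurable_fst
  exact (h1.mul ((measurable_pi_apply a).comp measurable_snd)).const_mul _

lemma unitScore_mk {K : ℕ} (u : Fin K → ℝ) (a : Fin K) (r : Fin K → ℝ) :
    unitScore u (a, r) = u a * r a := by
  simp [unitScore]

lemma sum_mul_scaledMean {K T : ℕ} {b : Fin T → ℝ} {n : ℕ} {Ω : Type*}
    (D : BatchedData K T b n Ω) (t : Fin T) (ω : Ω) (u : Fin K → ℝ) :
    ∑ a, u a * D.scaledMean t ω a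
      = ∑ j, 1 / (b t * √(n : ℝ)) * unitScore u (D.arm t j ω, D.reward t j ω) := by
  simp only [BatchedData.scaledMean, unitScore, Finset.mul_sum]
  rw [Finset.sum_comm]
  refine Finset.sum_congr rfl fun j _ => Finset.sum_congr rfl fun a _ => ?_
  ring

/-- The characteristic function of the contribution of one unit. -/
lemma integral_cexp_unitScore {K : ℕ} {p : Fin K → ℝ} (hp : p ∈ stdSimplex ℝ (Fin K))
    (q : Measure (Fin K → ℝ)) [IsProbabilityMeasure q] (u h : Fin K → ℝ) (β r : ℝ) :
    ∫ y, Complex.exp (((1 / (β * r) * unitScore u y : ℝ) : ℂ) * Complex.I)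
        ∂((armLaw p).prod (q.map fun e a => h a / r + e a))
      = ∑ a, (p a : ℂ) * ∫ e, Complex.exp (((r⁻¹ * (u a / β) * (r⁻¹ * h a + e a) : ℝ) : ℂ)
          * Complex.I) ∂q := by
  have := isProbabilityMeasure_armLaw hp
  have hm : Measurable fun (e : Fin K → ℝ) a => h a / r + e a := by fun_prop
  have := Measure.isProbabilityMeasure_map (μ := q) hm.aemeasurable
  have hF : Measurable fun y : Fin K × (Fin K → ℝ) =>
      Complex.exp (((1 / (β * r) * unitScore u y : ℝ) : ℂ) * Complex.I) := by
    have := measurable_unitScore u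
    fun_prop
  rw [integral_prod _ (Integrable.of_bound hF.aestronglyMeasurable 1 (Eventually.of_forall
    fun y => by rw [Complex.norm_exp_ofReal_mul_I])), integral_armLaw hp.1]
  refine Finset.sum_congr rfl fun a _ => ?_
  rw [integral_map hm.aemeasurable]
  · congr 1
    refine integral_congr_ae (Eventually.of_forall fun e => ?_)
    simp only [unitScore_mk]
    congr 3
    ring
  · exact (hF.comp measurable_prodMk_left).aestronglyMeasurable

/-- The conditional characteristic function of the aggregate rewards of one epoch is close to that
of the Gaussian experiment, uniformly in the sampling probabilities. -/
lemma IsNoiseModel.exists_norm_pow_sub_cexp_le {K : ℕ} {s : Fin K → ℝ}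
    {Q : ℕ → (Fin K → ℝ) → Measure (Fin K → ℝ)} (hQ : IsNoiseModel s Q) {β : ℝ} (hβ : 0 < β)
    (u : Fin K → ℝ) :
    ∃ S : (Fin K → ℝ) → ℝ, Measurable S ∧ ∀ n : ℕ, 1 ≤ n → ∀ h, ∀ p ∈ stdSimplex ℝ (Fin K),
      ‖(∑ a, (p a : ℂ) * ∫ e, Complex.exp ((((√(n : ℝ))⁻¹ * (u a / β)
            * ((√(n : ℝ))⁻¹ * h a + e a) : ℝ) : ℂ) * Complex.I) ∂(Q n h)) ^ ⌊β * n⌋₊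
          - Complex.exp (gaussExponent β s u h p)‖ ≤ (√(n : ℝ))⁻¹ * S h := by
  obtain ⟨M, hM0, hM⟩ := hQ.exists_third_moment
  let R : (Fin K → ℝ) → ℝ := fun h =>
    ∑ a, ((u a / β) ^ 2 * h a ^ 2 + 16 * |u a / β| ^ 3 * (|h a| ^ 3 + M))
  let B : (Fin K → ℝ) → ℝ := fun h =>
    ∑ a, ‖(u a * h a * Complex.I - u a ^ 2 * s a ^ 2 / (2 * β) : ℂ)‖
  -- With `ε = 1 / √n` and `δ = ε ^ 2 / β`, each unit costs `ε ^ 3 * R + 3 * δ ^ 2 * B ^ 2` and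
  -- rounding costs `2 * δ * B`. The total follows from `m * δ ≤ 1`, `ε ^ 3 = δ * β * ε` and `δ ≤ ε
  -- / β`.
  refine ⟨fun h => β * R h + 3 / β * B h ^ 2 + 2 / β * B h, by fun_prop, fun n hn h p hp => ?_⟩
  have := hQ.isProbabilityMeasure n h
  have hn' : (1 : ℝ) ≤ n := by exact_mod_cast hn
  have hr1 : 1 ≤ √(n : ℝ) := Real.one_le_sqrt.2 hn'
  set ε := (√(n : ℝ))⁻¹ with hε
  have hε0 : 0 < ε := by positivity
  have hε1 : ε ≤ 1 := inv_le_one_of_one_le₀ hr1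
  have hε2 : ε ^ 2 = (n : ℝ)⁻¹ := by rw [hε, inv_pow, Real.sq_sqrt (by positivity)]
  set φ := ∑ a, (p a : ℂ) * ∫ e, Complex.exp (((ε * (u a / β) * (ε * h a + e a) : ℝ) : ℂ)
    * Complex.I) ∂(Q n h) with hφ
  set z := gaussExponent β s u h p
  have hB : ‖z‖ ≤ B h := norm_gaussExponent_le β s u h hp
  have hB0 : 0 ≤ B h := (norm_nonneg _).trans hB
  have hz := gaussExponent_re_nonpos hβ s u h hp
  have hp1 : (∑ a, (p a : ℂ)) = 1 := by exact_mod_cast congrArg Complex.ofReal hp.2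
  have hφ1 : ‖φ‖ ≤ 1 := by
    refine (norm_sum_le _ _).trans ?_
    rw [← hp.2]
    refine Finset.sum_le_sum fun a _ => ?_
    rw [norm_mul, Complex.norm_real, Real.norm_of_nonneg (hp.1 a)]
    refine mul_le_of_le_one_right (hp.1 a) ?_
    refine (norm_integral_le_of_norm_le_const (C := 1) (Eventually.of_forall fun e => ?_)).trans
      (by simp)
    rw [Complex.norm_exp_ofReal_mul_I]
  have hR : ‖φ - 1 - (ε ^ 2 / β : ℝ) * z‖ ≤ ε ^ 3 * R h := by
    -- As the `p a` sum to 1, the error is a `p`-average of single-arm errors, each taken with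
    -- weight `w = u a / β`.
    have e : φ - 1 - (ε ^ 2 / β : ℝ) * z = ∑ a, (p a : ℂ) * (∫ e, Complex.exp
        (((ε * (u a / β) * (ε * h a + e a) : ℝ) : ℂ) * Complex.I) ∂(Q n h) - 1
        - (ε ^ 2 : ℝ) * ((u a / β : ℝ) * h a * Complex.I - (u a / β : ℝ) ^ 2 * s a ^ 2 / 2)) := by
      have e' : ∀ x y w : ℂ, w * (x - 1 - y) = w * x - w - w * y := fun x y w => by ring
      simp only [e', Finset.sum_sub_distrib, hp1, ← hφ]
      congr 1
      simp only [z, gaussExponent, Finset.mul_sum]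
      refine Finset.sum_congr rfl fun a _ => ?_
      have : (β : ℂ) ≠ 0 := by exact_mod_cast hβ.ne'
      push_cast
      field_simp
    rw [e, Finset.mul_sum]
    refine (norm_sum_le _ _).trans (Finset.sum_le_sum fun a _ => ?_)
    rw [norm_mul, Complex.norm_real, Real.norm_of_nonneg (hp.1 a)]
    refine (mul_le_of_le_one_left (norm_nonneg _) (mem_Icc_of_mem_stdSimplex hp a).2).trans ?_
    exact norm_integral_cexp_shift_sub_le (Q n h) a (hQ.mean_eq_zero n h a)
      (hQ.variance_eq n h a) (hM n h a).1 (hM n h a).2 hε0.le hε1 _ _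
  have hR0 : 0 ≤ R h := Finset.sum_nonneg fun a _ => by positivity
  set m := ⌊β * (n : ℝ)⌋₊
  set δ := ε ^ 2 / β with hδ
  have hδn : β * n * δ = 1 := by rw [hδ, hε2]; field_simp
  have hδ0 : 0 < δ := by positivity
  have hm1 : m * δ ≤ 1 := by
    rw [← hδn]; gcongr; exact Nat.floor_le (by positivity)
  have hm2 : 1 ≤ m * δ + δ := by
    rw [← hδn, ← add_one_mul]; gcongr; exact (Nat.lt_floor_add_one _).le
  refine (norm_pow_sub_cexp_le hφ1 hz hδ0.le hm1 hm2).trans ?_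
  have hδε : δ ≤ ε / β := by
    rw [hδ]; gcongr; nlinarith
  calc m * (‖φ - 1 - δ * z‖ + 3 * δ ^ 2 * ‖z‖ ^ 2) + 2 * δ * ‖z‖
      ≤ m * (ε ^ 3 * R h + 3 * δ ^ 2 * B h ^ 2) + 2 * δ * B h := by gcongr
    _ = m * δ * (β * ε * R h + 3 * δ * B h ^ 2) + 2 * δ * B h := by
        have : ε ^ 3 = δ * (β * ε) := by rw [hδ]; field_simp
        rw [this]; ring
    _ ≤ 1 * (β * ε * R h + 3 * (ε / β) * B h ^ 2) + 2 * (ε / β) * B h := by gcongr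
    _ = _ := by ring

lemma measurable_past {K T : ℕ} {Ω : Type*} [MeasurableSpace Ω] {h : Ω → Fin K → ℝ}
    {obs : Fin T → Ω → Fin K → ℝ} (hh : Measurable h) (hobs : ∀ t, Measurable (obs t))
    (t : ℕ) (ht : t ≤ T) : Measurable (past h obs t ht) :=
  hh.prodMk (measurable_pi_lambda _ fun i => hobs (Fin.castLE ht i))

lemma measurable_gaussExponent {K : ℕ} (β : ℝ) (s u : Fin K → ℝ) :
    Measurable fun x : (Fin K → ℝ) × (Fin K → ℝ) => gaussExponent β s u x.1 x.2 := by
  unfold gaussExponent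
  fun_prop

lemma continuous_gaussExponent {K : ℕ} (β : ℝ) (s u : Fin K → ℝ) :
    Continuous fun x : (Fin K → ℝ) × (Fin K → ℝ) => gaussExponent β s u x.1 x.2 := by
  unfold gaussExponent
  fun_prop

/-- The limiting conditional characteristic function of one epoch, as a function of the past. -/
noncomputable def epochCharFun {K : ℕ} (π : AdaptivePolicy K) (β : ℝ) (s u : Fin K → ℝ) (t : ℕ)
    (x : (Fin K → ℝ) × (Fin t → Fin K → ℝ)) : ℂ :=
  Complex.exp (gaussExponent β s u x.1 (π.prob t x.2))

lemma measurable_epochCharFun {K : ℕ} (π : AdaptivePolicy K) (β : ℝ) (s u : Fin K → ℝ) (t : ℕ) :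
    Measurable (epochCharFun π β s u t) :=
  Complex.measurable_exp.comp ((measurable_gaussExponent β s u).comp
    (measurable_fst.prodMk ((π.measurable_prob t).comp measurable_snd)))

lemma norm_epochCharFun_le {K : ℕ} (π : AdaptivePolicy K) {β : ℝ} (hβ : 0 < β) (s u : Fin K → ℝ)
    (t : ℕ) (x : (Fin K → ℝ) × (Fin t → Fin K → ℝ)) : ‖epochCharFun π β s u t x‖ ≤ 1 :=
  norm_cexp_le_one (gaussExponent_re_nonpos hβ s u x.1 (π.prob_mem t x.2))

lemma continuousAt_epochCharFun {K : ℕ} (π : AdaptivePolicy K) (β : ℝ) (s u : Fin K → ℝ) (t : ℕ)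
    {x : (Fin K → ℝ) × (Fin t → Fin K → ℝ)} (hx : ContinuousAt (π.prob t) x.2) :
    ContinuousAt (epochCharFun π β s u t) x := by
  have h1 : ContinuousAt (fun x : (Fin K → ℝ) × (Fin t → Fin K → ℝ) => (x.1, π.prob t x.2)) x :=
    continuousAt_fst.prodMk (hx.comp continuousAt_snd)
  exact Complex.continuous_exp.continuousAt.comp
    ((continuous_gaussExponent β s u).continuousAt.comp h1)

/-! ### Comparison of one batched epoch with its Gaussian limit. -/

section Batched

variable {K T : ℕ} [NeZero K] {b : Fin T → ℝ} {n : ℕ} {Ω : Type*} [MeasurableSpace Ω]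
  {P : Measure Ω} [IsProbabilityMeasure P] {ν : Measure (Fin K → ℝ)} {π : AdaptivePolicy K}
  {Q : ℕ → (Fin K → ℝ) → Measure (Fin K → ℝ)} {D : BatchedData K T b n Ω}

lemma IsBatchedExperiment.measurable_scaledMean (hD : IsBatchedExperiment P ν π Q D) (t : Fin T) :
    Measurable (D.scaledMean t) := by
  refine measurable_pi_lambda _ fun a => ?_
  unfold BatchedData.scaledMean
  refine (Finset.measurable_sum _ fun j _ => ?_).const_mul _
  have h1 : Measurable fun ω => if D.arm t j ω = a then (1 : ℝ) else 0 :=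
    (Measurable.of_discrete (f := fun i : Fin K => if i = a then (1 : ℝ) else 0)).comp
      (hD.measurable_arm t j)
  exact h1.mul ((measurable_pi_apply a).comp (hD.measurable_reward t j))

/-- The conditional law of the units of an epoch. -/
lemma IsBatchedExperiment.condDistrib_units (hD : IsBatchedExperiment P ν π Q D) (t : Fin T) :
    ∀ᵐ x ∂(P.map (past D.h D.scaledMean t t.isLt.le)),
      condDistrib (fun ω j => (D.arm t j ω, D.reward t j ω))
          (past D.h D.scaledMean t t.isLt.le) P x =
        Measure.pi fun _ => (armLaw (π.prob t x.2)).prod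
          ((Q n x.1).map fun e a => x.1 a / √(n : ℝ) + e a) := by
  filter_upwards [hD.units_indep t, ae_all_iff.2 (hD.ignorability t), ae_all_iff.2 (hD.arm_law t),
    ae_all_iff.2 (hD.reward_law t)] with x h1 h2 h3 h4
  rw [h1]
  congr 1
  funext j
  rw [h2, h3, h4]

/-- The conditional characteristic function of the aggregate rewards of one epoch. -/
lemma IsBatchedExperiment.integral_units (hQ : ∀ n h, IsProbabilityMeasure (Q n h))
    (hD : IsBatchedExperiment P ν π Q D) (t : Fin T) (u : Fin K → ℝ) :
    ∀ᵐ x ∂(P.map (past D.h D.scaledMean t t.isLt.le)),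
      ∫ y, Complex.exp (((∑ j, 1 / (b t * √(n : ℝ)) * unitScore u (y j) : ℝ) : ℂ) * Complex.I)
        ∂(condDistrib (fun ω j => (D.arm t j ω, D.reward t j ω))
          (past D.h D.scaledMean t t.isLt.le) P x)
      = (∑ a, (π.prob t x.2 a : ℂ) * ∫ e, Complex.exp ((((√(n : ℝ))⁻¹ * (u a / b t)
            * ((√(n : ℝ))⁻¹ * x.1 a + e a) : ℝ) : ℂ) * Complex.I) ∂(Q n x.1)) ^ ⌊b t * n⌋₊ := by
  filter_upwards [hD.condDistrib_units t] with x hx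
  have := hQ n x.1
  have := isProbabilityMeasure_armLaw (π.prob_mem t x.2)
  have hm : Measurable fun (e : Fin K → ℝ) a => x.1 a / √(n : ℝ) + e a := by fun_prop
  have := Measure.isProbabilityMeasure_map (μ := Q n x.1) hm.aemeasurable
  rw [hx]
  have e : ∀ y : Fin (batchSize b n t) → Fin K × (Fin K → ℝ),
      Complex.exp (((∑ j, 1 / (b t * √(n : ℝ)) * unitScore u (y j) : ℝ) : ℂ) * Complex.I)
      = ∏ j, Complex.exp (((1 / (b t * √(n : ℝ)) * unitScore u (y j) : ℝ) : ℂ) * Complex.I) := by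
    intro y
    rw [← Complex.exp_sum, Complex.ofReal_sum, Finset.sum_mul]
  simp only [e]
  rw [integral_fintype_prod_eq_prod (fun _ y => Complex.exp (((1 / (b t * √(n : ℝ))
    * unitScore u y : ℝ) : ℂ) * Complex.I))]
  rw [integral_cexp_unitScore (π.prob_mem t x.2)]
  rw [Finset.prod_const, Finset.card_univ, Fintype.card_fin]
  rfl

/-- The error of replacing the aggregate rewards of one epoch by Gaussian observations. -/
lemma IsBatchedExperiment.norm_integral_sub_le (hQ : ∀ n h, IsProbabilityMeasure (Q n h))
    (hb : ∀ t, 0 < b t) (hD : IsBatchedExperiment P ν π Q D) (t : Fin T) (s u : Fin K → ℝ)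
    {B : (Fin K → ℝ) → ℝ} (hBm : Measurable B)
    (hB : ∀ h, ∀ p ∈ stdSimplex ℝ (Fin K),
      ‖(∑ a, (p a : ℂ) * ∫ e, Complex.exp ((((√(n : ℝ))⁻¹ * (u a / b t)
            * ((√(n : ℝ))⁻¹ * h a + e a) : ℝ) : ℂ) * Complex.I) ∂(Q n h)) ^ ⌊b t * n⌋₊
          - Complex.exp (gaussExponent (b t) s u h p)‖ ≤ B h)
    {f : (Fin K → ℝ) × (Fin t → Fin K → ℝ) → ℂ} (hf : Measurable f) (hf1 : ∀ x, ‖f x‖ ≤ 1) :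
    ‖∫ ω, f (past D.h D.scaledMean t t.isLt.le ω)
          * Complex.exp (((∑ a, u a * D.scaledMean t ω a : ℝ) : ℂ) * Complex.I) ∂P
        - ∫ x, f x * epochCharFun π (b t) s u t x ∂(P.map (past D.h D.scaledMean t t.isLt.le))‖
      ≤ ∫ h, min 2 (B h) ∂ν := by
  set X := past D.h D.scaledMean t t.isLt.le
  have hX : Measurable X := measurable_past hD.measurable_h hD.measurable_scaledMean t t.isLt.le
  let Y : Ω → Fin (batchSize b n t) → Fin K × (Fin K → ℝ) :=
    fun ω j => (D.arm t j ω, D.reward t j ω)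
  have hY : Measurable Y :=
    measurable_pi_lambda _ fun j => (hD.measurable_arm t j).prodMk (hD.measurable_reward t j)
  let g : (Fin (batchSize b n t) → Fin K × (Fin K → ℝ)) → ℂ := fun y =>
    Complex.exp (((∑ j, 1 / (b t * √(n : ℝ)) * unitScore u (y j) : ℝ) : ℂ) * Complex.I)
  have hg : Measurable g := by
    have := measurable_unitScore u
    fun_prop
  have hg1 : ∀ y, ‖g y‖ = 1 := fun y => Complex.norm_exp_ofReal_mul_I _
  have := Measure.isProbabilityMeasure_map (μ := P) hX.aemeasurable
  have e1 : ∫ ω, f (X ω) * Complex.exp (((∑ a, u a * D.scaledMean t ω a : ℝ) : ℂ) * Complex.I) ∂P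
      = ∫ x, f x * ∫ y, g y ∂(condDistrib Y X P x) ∂(P.map X) := by
    simp only [sum_mul_scaledMean]
    exact integral_mul_comp_condDistrib P hX hY hf hg hf1 fun y => (hg1 y).le
  have hgm : Measurable fun x => ∫ y, g y ∂(condDistrib Y X P x) :=
    (StronglyMeasurable.integral_kernel (κ := condDistrib Y X P) hg.stronglyMeasurable).measurable
  have hgi : ∀ x, ‖∫ y, g y ∂(condDistrib Y X P x)‖ ≤ 1 := fun x =>
    (norm_integral_le_of_norm_le_const (C := 1) (Eventually.of_forall fun y => (hg1 y).le)).trans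
      (by simp)
  have hψ := measurable_epochCharFun π (b t) s u t
  have hψ1 := norm_epochCharFun_le π (hb t) s u t
  have i1 : Integrable (fun x => f x * ∫ y, g y ∂(condDistrib Y X P x)) (P.map X) :=
    Integrable.of_bound (hf.mul hgm).aestronglyMeasurable 1 (Eventually.of_forall fun x => by
      rw [norm_mul]; exact mul_le_one₀ (hf1 x) (norm_nonneg _) (hgi x))
  have i2 : Integrable (fun x => f x * epochCharFun π (b t) s u t x) (P.map X) :=
    Integrable.of_bound (hf.mul hψ).aestronglyMeasurable 1 (Eventually.of_forall fun x => by
      rw [norm_mul]; exact mul_le_one₀ (hf1 x) (norm_nonneg _) (hψ1 x))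
  -- The simplex is nonempty because `K ≠ 0`, so the hypothesis on `B` forces it to be nonnegative.
  have hB0 : ∀ h, 0 ≤ B h := fun h => (norm_nonneg _).trans
    (hB h (Pi.single 0 1) (single_mem_stdSimplex ℝ 0))
  have hν : ν = (P.map X).map Prod.fst := by
    rw [Measure.map_map measurable_fst hX, ← hD.map_h]; rfl
  rw [hν, integral_map measurable_fst.aemeasurable
    (measurable_const.min hBm).aestronglyMeasurable, e1, ← integral_sub i1 i2]
  refine norm_integral_le_of_norm_le ?_ ?_
  · refine Integrable.of_bound (C := 2)
      (measurable_const.min (hBm.comp measurable_fst)).aestronglyMeasurable (Eventually.of_forall fun x => ?_)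
    rw [Real.norm_of_nonneg (le_min zero_le_two (hB0 _))]
    exact min_le_left _ _
  · filter_upwards [hD.integral_units hQ t u] with x hx
    rw [← mul_sub, norm_mul]
    -- Both conditional characteristic functions lie in the unit disc, whence the cap 2; it frees
    -- the argument from any integrability of `B`.
    refine (mul_le_of_le_one_left (norm_nonneg _) (hf1 x)).trans (le_min ?_ ?_)
    · exact (norm_sub_le _ _).trans (by linarith [hgi x, hψ1 x])
    · change ‖(∫ y, g y ∂(condDistrib Y X P x)) - _‖ ≤ _
      simp only [g, X, Y]
      rw [hx]
      exact hB x.1 _ (π.prob_mem t x.2)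

end Batched

/-- A product of one-dimensional Gaussian characteristic functions. The formula includes variance 0,
so arms with `p a = 0` or `s a = 0` need no separate treatment. -/
lemma integral_cexp_pi_gaussianReal {K : ℕ} {β : ℝ} (hβ : 0 < β) (s u h : Fin K → ℝ) {p : Fin K → ℝ}
    (hp : p ∈ stdSimplex ℝ (Fin K)) :
    ∫ y, Complex.exp (((∑ a, u a * y a : ℝ) : ℂ) * Complex.I)
        ∂(Measure.pi fun a => gaussianReal (p a * h a) (Real.toNNReal (p a * s a ^ 2 / β)))
      = Complex.exp (gaussExponent β s u h p) := by
  have e : ∀ y : Fin K → ℝ, Complex.exp (((∑ a, u a * y a : ℝ) : ℂ) * Complex.I)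
      = ∏ a, Complex.exp (u a * y a * Complex.I) := by
    intro y
    rw [← Complex.exp_sum, Complex.ofReal_sum, Finset.sum_mul]
    simp
  simp only [e]
  rw [integral_fintype_prod_eq_prod (fun a (y : ℝ) => Complex.exp (u a * y * Complex.I)),
    gaussExponent, Complex.exp_sum]
  refine Finset.prod_congr rfl fun a _ => ?_
  rw [← charFun_apply_real, charFun_gaussianReal,
    Real.coe_toNNReal _ (div_nonneg (mul_nonneg (hp.1 a) (sq_nonneg _)) hβ.le)]
  congr 1
  have : (β : ℂ) ≠ 0 := by exact_mod_cast hβ.ne'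
  push_cast
  field_simp

section Gaussian

variable {K T : ℕ} [NeZero K] {b : Fin T → ℝ} {s : Fin K → ℝ} {Ω : Type*} [MeasurableSpace Ω]
  {P : Measure Ω} [IsProbabilityMeasure P] {ν : Measure (Fin K → ℝ)} {π : AdaptivePolicy K}
  {E : GaussianData K T Ω}

/-- The Gaussian counterpart of `IsBatchedExperiment.norm_integral_sub_le`, with no error term. -/
lemma IsGaussianExperiment.integral_mul_cexp (hb : ∀ t, 0 < b t)
    (hE : IsGaussianExperiment P b s ν π E) (t : Fin T) (u : Fin K → ℝ)
    {f : (Fin K → ℝ) × (Fin t → Fin K → ℝ) → ℂ} (hf : Measurable f) (hf1 : ∀ x, ‖f x‖ ≤ 1) :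
    ∫ ω, f (past E.h E.G t t.isLt.le ω)
        * Complex.exp (((∑ a, u a * E.G t ω a : ℝ) : ℂ) * Complex.I) ∂P
      = ∫ x, f x * epochCharFun π (b t) s u t x ∂(P.map (past E.h E.G t t.isLt.le)) := by
  have hX := measurable_past hE.measurable_h hE.measurable_G t t.isLt.le
  have hg : Measurable fun y : Fin K → ℝ =>
      Complex.exp (((∑ a, u a * y a : ℝ) : ℂ) * Complex.I) := by fun_prop
  refine (integral_mul_comp_condDistrib P hX (hE.measurable_G t) hf hg hf1 fun y => by
    rw [Complex.norm_exp_ofReal_mul_I]).trans ?_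
  refine integral_congr_ae ?_
  filter_upwards [hE.G_law t] with x hx
  rw [hx, integral_cexp_pi_gaussianReal (hb t) s u x.1 (π.prob_mem t x.2), epochCharFun]

end Gaussian

/-! ### Weak convergence of the pasts. -/

/-- Dominated convergence with the constant 2. `S` need not be integrable, so its growth in `h`
costs no moment of the prior. -/
lemma tendsto_integral_min_inv_sqrt_mul {α : Type*} [MeasurableSpace α] (ν : Measure α)
    [IsFiniteMeasure ν] {S : α → ℝ} (hS : Measurable S) :
    Tendsto (fun n : ℕ => ∫ h, min 2 ((√(n : ℝ))⁻¹ * |S h|) ∂ν) atTop (𝓝 0) := by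
  have hlim : Tendsto (fun n : ℕ => (√(n : ℝ))⁻¹) atTop (𝓝 0) :=
    (Real.tendsto_sqrt_atTop.comp tendsto_natCast_atTop_atTop).inv_tendsto_atTop
  rw [← integral_zero α ℝ (μ := ν)]
  refine tendsto_integral_of_dominated_convergence (fun _ => 2) (fun n => ?_) (integrable_const 2)
    (fun n => Eventually.of_forall fun h => ?_) (Eventually.of_forall fun h => ?_)
  · exact (measurable_const.min (hS.abs.const_mul _)).aestronglyMeasurable
  · rw [Real.norm_of_nonneg (le_min zero_le_two (by positivity))]
    exact min_le_left _ _
  · have := (tendsto_const_nhds (x := (2 : ℝ))).min (hlim.mul_const |S h|)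
    simpa using this

lemma map_past_zero {K T : ℕ} {Ω : Type*} [MeasurableSpace Ω] (P : Measure Ω)
    {h : Ω → Fin K → ℝ} (hh : Measurable h) (obs : Fin T → Ω → Fin K → ℝ) :
    P.map (past h obs 0 T.zero_le) = (P.map h).map fun x => (x, finZeroElim) := by
  rw [Measure.map_map (by fun_prop) hh]
  congr 1
  funext ω
  exact Prod.ext rfl (Subsingleton.elim _ _)

lemma past_succ {K T : ℕ} {Ω : Type*} (h : Ω → Fin K → ℝ) (obs : Fin T → Ω → Fin K → ℝ) (t : ℕ)
    (ht : t + 1 ≤ T) (ω : Ω) : past h obs (t + 1) ht ω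
      = ((past h obs t (Nat.le_of_succ_le ht) ω).1, Fin.snoc (α := fun _ => Fin K → ℝ)
          (past h obs t (Nat.le_of_succ_le ht) ω).2 (obs ⟨t, ht⟩ ω)) := by
  refine Prod.ext rfl ?_
  funext i
  refine Fin.lastCases ?_ (fun j => ?_) i
  · simp only [Fin.snoc_last]; rfl
  · simp only [Fin.snoc_castSucc]; rfl

/-- A linear functional of the past of the next epoch splits into a part depending on the present
past and a part depending on the new observations. -/
lemma exists_apply_snoc {K : ℕ} (t : ℕ)
    (l : ((Fin K → ℝ) × (Fin (t + 1) → Fin K → ℝ)) →L[ℝ] ℝ) :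
    ∃ (c : ((Fin K → ℝ) × (Fin t → Fin K → ℝ)) → ℝ) (u : Fin K → ℝ), Continuous c ∧
      ∀ x z, l (x.1, Fin.snoc (α := fun _ => Fin K → ℝ) x.2 z) = c x + ∑ a, u a * z a := by
  refine ⟨fun x => l (x.1, Fin.snoc (α := fun _ => Fin K → ℝ) x.2 0),
    fun a => l (0, Pi.single (Fin.last t) (Pi.single a 1)), ?_, fun x z => ?_⟩
  · refine l.continuous.comp (continuous_fst.prodMk ?_)
    exact Continuous.finSnoc (A := fun _ => Fin K → ℝ) continuous_snd continuous_const
  · have e : (x.1, Fin.snoc (α := fun _ => Fin K → ℝ) x.2 z)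
        = (x.1, Fin.snoc (α := fun _ => Fin K → ℝ) x.2 0)
          + ∑ a, z a • ((0 : Fin K → ℝ),
            (Pi.single (Fin.last t) (Pi.single a 1) : Fin (t + 1) → Fin K → ℝ)) := by
      refine Prod.ext ?_ ?_
      · simp [Prod.fst_sum]
      · simp only [Prod.snd_add, Prod.snd_sum, Prod.smul_snd]
        funext i b
        refine Fin.lastCases ?_ (fun j => ?_) i
        · simp [Finset.sum_apply, Pi.single_apply]
        · simp [Finset.sum_apply, Fin.castSucc_ne_last]
    rw [e, map_add, map_sum]
    congr 1
    refine Finset.sum_congr rfl fun a _ => ?_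
    rw [map_smul, smul_eq_mul, mul_comm]

lemma ae_continuousAt_prob {K T : ℕ} {Ω : Type*} [MeasurableSpace Ω] {P : Measure Ω}
    (π : AdaptivePolicy K) {h : Ω → Fin K → ℝ} {obs : Fin T → Ω → Fin K → ℝ}
    (hh : Measurable h) (hobs : ∀ t, Measurable (obs t)) {t : ℕ} (ht : t ≤ T)
    (hπ : P.map (history obs t ht) {r | ¬ ContinuousAt (π.prob t) r} = 0) :
    ∀ᵐ x ∂(P.map (past h obs t ht)), ContinuousAt (π.prob t) x.2 := by
  have hX := measurable_past hh hobs t ht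
  have e : P.map (history obs t ht) = (P.map (past h obs t ht)).map Prod.snd := by
    rw [Measure.map_map measurable_snd hX]; rfl
  rw [e] at hπ
  exact ae_of_ae_map measurable_snd.aemeasurable (ae_iff.2 hπ)

/-- The joint law of the average rewards and the first `t` observations. -/
noncomputable def pastLaw {K T : ℕ} {Ω : Type*} [MeasurableSpace Ω] (P : Measure Ω)
    [IsProbabilityMeasure P] {h : Ω → Fin K → ℝ} {obs : Fin T → Ω → Fin K → ℝ}
    (hh : Measurable h) (hobs : ∀ t, Measurable (obs t)) (t : ℕ) (ht : t ≤ T) :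
    ProbabilityMeasure ((Fin K → ℝ) × (Fin t → Fin K → ℝ)) :=
  ⟨P.map (past h obs t ht),
    Measure.isProbabilityMeasure_map (measurable_past hh hobs t ht).aemeasurable⟩

lemma integral_cexp_pastLaw_succ {K T : ℕ} {Ω : Type*} [MeasurableSpace Ω] (P : Measure Ω)
    [IsProbabilityMeasure P] {h : Ω → Fin K → ℝ} {obs : Fin T → Ω → Fin K → ℝ}
    (hh : Measurable h) (hobs : ∀ t, Measurable (obs t)) {t : ℕ} (ht : t + 1 ≤ T)
    (l : ((Fin K → ℝ) × (Fin (t + 1) → Fin K → ℝ)) →L[ℝ] ℝ)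
    {c : ((Fin K → ℝ) × (Fin t → Fin K → ℝ)) → ℝ} {u : Fin K → ℝ}
    (hl : ∀ x z, l (x.1, Fin.snoc (α := fun _ => Fin K → ℝ) x.2 z) = c x + ∑ a, u a * z a) :
    ∫ x, Complex.exp (l x * Complex.I) ∂(pastLaw P hh hobs (t + 1) ht : Measure _)
      = ∫ ω, Complex.exp (c (past h obs t (Nat.le_of_succ_le ht) ω) * Complex.I)
          * Complex.exp (((∑ a, u a * obs ⟨t, ht⟩ ω a : ℝ) : ℂ) * Complex.I) ∂P := by
  have hX := measurable_past hh hobs (t + 1) ht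
  change ∫ x, Complex.exp (l x * Complex.I) ∂(P.map (past h obs (t + 1) ht)) = _
  have hm : Measurable fun x => Complex.exp (l x * Complex.I) := by
    have := l.continuous.measurable
    fun_prop
  rw [integral_map hX.aemeasurable hm.aestronglyMeasurable]
  refine integral_congr_ae (Eventually.of_forall fun ω => ?_)
  simp only [past_succ h obs t ht, hl]
  rw [← Complex.exp_add, ← add_mul, ← Complex.ofReal_add]

section Limit

variable {K T : ℕ} [NeZero K] {b : Fin T → ℝ} {s : Fin K → ℝ} {ν : Measure (Fin K → ℝ)}
  [IsProbabilityMeasure ν] {π : AdaptivePolicy K} {Q : ℕ → (Fin K → ℝ) → Measure (Fin K → ℝ)}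
  {Ω : ℕ → Type*} [∀ n, MeasurableSpace (Ω n)] {P : (n : ℕ) → Measure (Ω n)}
  [∀ n, IsProbabilityMeasure (P n)] {D : (n : ℕ) → BatchedData K T b n (Ω n)}
  {Ω' : Type*} [MeasurableSpace Ω'] {P' : Measure Ω'} [IsProbabilityMeasure P']
  {E : GaussianData K T Ω'}

/-- The aggregate rewards of one epoch may be replaced by Gaussian observations in the limit. -/
lemma tendsto_integral_mul_cexp_sub (hb : ∀ t, 0 < b t) (hQ : IsNoiseModel s Q)
    (hD : ∀ n, IsBatchedExperiment (P n) ν π Q (D n)) (t : Fin T) (u : Fin K → ℝ)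
    {f : (Fin K → ℝ) × (Fin t → Fin K → ℝ) → ℂ} (hf : Measurable f) (hf1 : ∀ x, ‖f x‖ ≤ 1) :
    Tendsto (fun n =>
      ∫ ω, f (past (D n).h (D n).scaledMean t t.isLt.le ω)
          * Complex.exp (((∑ a, u a * (D n).scaledMean t ω a : ℝ) : ℂ) * Complex.I) ∂(P n)
        - ∫ x, f x * epochCharFun π (b t) s u t x
            ∂((P n).map (past (D n).h (D n).scaledMean t t.isLt.le))) atTop (𝓝 0) := by
  obtain ⟨S, hSm, hS⟩ := hQ.exists_norm_pow_sub_cexp_le (hb t) u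
  refine squeeze_zero_norm' ?_ (tendsto_integral_min_inv_sqrt_mul ν hSm)
  filter_upwards [eventually_ge_atTop 1] with n hn
  refine (hD n).norm_integral_sub_le hQ.isProbabilityMeasure hb t s u (hSm.abs.const_mul _)
    (fun h p hp => (hS n hn h p hp).trans ?_) hf hf1
  gcongr
  exact le_abs_self _

/-- Weak convergence of the pasts of the batched experiments to that of the Gaussian experiment. -/
lemma tendsto_pastLaw (hb : ∀ t, 0 < b t) (hQ : IsNoiseModel s Q)
    (hD : ∀ n, IsBatchedExperiment (P n) ν π Q (D n)) (hE : IsGaussianExperiment P' b s ν π E)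
    (hπ : ∀ (t : ℕ) (ht : t ≤ T),
      P'.map (history E.G t ht) {r | ¬ ContinuousAt (π.prob t) r} = 0) (t : ℕ) (ht : t ≤ T) :
    Tendsto (fun n => pastLaw (P n) (hD n).measurable_h (hD n).measurable_scaledMean t ht) atTop
      (𝓝 (pastLaw P' hE.measurable_h hE.measurable_G t ht)) := by
  induction t with
  | zero =>
    have e : ∀ n, pastLaw (P n) (hD n).measurable_h (hD n).measurable_scaledMean 0 ht
        = pastLaw P' hE.measurable_h hE.measurable_G 0 ht := fun n => by
      refine Subtype.ext ?_
      change (P n).map (past _ _ 0 _) = P'.map (past _ _ 0 _)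
      rw [map_past_zero _ (hD n).measurable_h, map_past_zero _ hE.measurable_h, (hD n).map_h,
        hE.map_h]
    simp only [e]
    exact tendsto_const_nhds
  | succ t ih =>
    have ht' : t ≤ T := Nat.le_of_succ_le ht
    refine tendsto_of_tendsto_integral_cexp fun l => ?_
    obtain ⟨c, u, hc, hl⟩ := exists_apply_snoc t l
    simp only [integral_cexp_pastLaw_succ _ _ _ ht l hl]
    let f : (Fin K → ℝ) × (Fin t → Fin K → ℝ) → ℂ := fun x => Complex.exp (c x * Complex.I)
    have hfc : Continuous f := by fun_prop
    have hf1 : ∀ x, ‖f x‖ ≤ 1 := fun x => (Complex.norm_exp_ofReal_mul_I _).le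
    have hψ := measurable_epochCharFun π (b ⟨t, ht⟩) s u t
    -- The batched functional is a vanishing error (`h1`) plus an integral against the law of the
    -- shorter past. The latter converges by induction (`h2`), and its limit is exactly the Gaussian
    -- functional (`h4`).
    have h1 := tendsto_integral_mul_cexp_sub hb hQ hD ⟨t, ht⟩ u hfc.measurable hf1
    have h2 := tendsto_integral_of_ae_continuousAt (ih ht')
      (g := fun x => f x * epochCharFun π (b ⟨t, ht⟩) s u t x) (hfc.measurable.mul hψ)
      ((ae_continuousAt_prob π hE.measurable_h hE.measurable_G ht' (hπ t ht')).mono fun x hx =>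
        hfc.continuousAt.mul (continuousAt_epochCharFun π _ s u t hx)) (C := 1) fun x => by
          rw [norm_mul]
          exact mul_le_one₀ (hf1 x) (norm_nonneg _) (norm_epochCharFun_le π (hb _) s u t x)
    have h3 := h1.add h2
    rw [zero_add] at h3
    have h4 := hE.integral_mul_cexp hb ⟨t, ht⟩ u hfc.measurable hf1
    refine Tendsto.congr (fun n => ?_) (h3.trans (le_of_eq (congrArg 𝓝 h4.symm)))
    exact sub_add_cancel _ _

end Limit

/-! ### Truncation and the Bayes simple regret. -/

/-- Truncation of a real number to the interval `[-M, M]`. -/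
noncomputable def truncate (M x : ℝ) : ℝ := max (-M) (min x M)

lemma continuous_truncate (M : ℝ) : Continuous (truncate M) := by
  unfold truncate; fun_prop

lemma abs_truncate_le {M : ℝ} (hM : 0 ≤ M) (x : ℝ) : |truncate M x| ≤ M := by
  unfold truncate
  exact abs_le.2 ⟨le_max_left _ _, max_le (by linarith) (min_le_right _ _)⟩

lemma abs_sub_truncate_le {M : ℝ} (hM : 0 ≤ M) (x : ℝ) : |x - truncate M x| ≤ |x| := by
  unfold truncate
  grind

lemma truncate_eq_self {M x : ℝ} (h : |x| ≤ M) : truncate M x = x := by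
  unfold truncate
  grind

/-- Dominated convergence: the integrand is at most `∑ a, |h a|` and vanishes once `N` exceeds this
sum. -/
lemma tendsto_integral_sum_abs_sub_truncate {K : ℕ} {ν : Measure (Fin K → ℝ)}
    (hν : Integrable (fun h : Fin K → ℝ => ∑ a, |h a|) ν) :
    Tendsto (fun N : ℕ => ∫ h : Fin K → ℝ, ∑ a, |h a - truncate N (h a)| ∂ν) atTop (𝓝 0) := by
  rw [← integral_zero (Fin K → ℝ) ℝ (μ := ν)]
  refine tendsto_integral_of_dominated_convergence _ (fun N => ?_) hν
    (fun N => Eventually.of_forall fun h => ?_) (Eventually.of_forall fun h => ?_)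
  · have := continuous_truncate N
    exact Continuous.aestronglyMeasurable (by fun_prop)
  · rw [Real.norm_of_nonneg (Finset.sum_nonneg fun a _ => abs_nonneg _)]
    exact Finset.sum_le_sum fun a _ => abs_sub_truncate_le N.cast_nonneg _
  · refine tendsto_const_nhds.congr' ?_
    obtain ⟨N₀, hN₀⟩ := exists_nat_ge (∑ a, |h a|)
    filter_upwards [eventually_ge_atTop N₀] with N hN
    refine (Finset.sum_eq_zero fun a _ => ?_).symm
    rw [truncate_eq_self, sub_self, abs_zero]
    have h1 := Finset.single_le_sum (f := fun a => |h a|) (fun a _ => abs_nonneg _)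
      (Finset.mem_univ a)
    have h2 : (N₀ : ℝ) ≤ N := by exact_mod_cast hN
    exact h1.trans (hN₀.trans h2)

lemma measurable_apply_choice {K : ℕ} {Ω : Type*} [MeasurableSpace Ω] {h : Ω → Fin K → ℝ}
    {choice : Ω → Fin K} (hh : Measurable h) (hc : Measurable choice) :
    Measurable fun ω => h ω (choice ω) := by
  -- Evaluation at a random index is a sum of indicators, that is, `unitScore` with all weights 1.
  have e : (fun ω => h ω (choice ω)) = fun ω => unitScore (fun _ => 1) (choice ω, h ω) := by
    funext ω
    rw [unitScore_mk, one_mul]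
  rw [e]
  exact (measurable_unitScore _).comp (hc.prodMk hh)

lemma integrable_apply_choice {K : ℕ} {Ω : Type*} [MeasurableSpace Ω] {P : Measure Ω}
    {ν : Measure (Fin K → ℝ)} {h : Ω → Fin K → ℝ} {choice : Ω → Fin K} (hh : Measurable h)
    (hc : Measurable choice) (hmap : P.map h = ν)
    (hν : Integrable (fun h : Fin K → ℝ => ∑ a, |h a|) ν) :
    Integrable (fun ω => h ω (choice ω)) P := by
  subst hmap
  refine (hν.comp_measurable hh).mono' (measurable_apply_choice hh hc).aestronglyMeasurable
    (Eventually.of_forall fun ω => ?_)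
  exact Finset.single_le_sum (f := fun a => |h ω a|) (fun a _ => abs_nonneg _)
    (Finset.mem_univ (choice ω))

/-- The expected value of a bounded function of the reward of the selected arm. -/
lemma integral_apply_choice {K T : ℕ} [NeZero K] {Ω : Type*} [MeasurableSpace Ω] {P : Measure Ω}
    [IsProbabilityMeasure P] {h : Ω → Fin K → ℝ} {choice : Ω → Fin K} {π : AdaptivePolicy K}
    {obs : Fin T → Ω → Fin K → ℝ}
    (hh : Measurable h) (hobs : ∀ t, Measurable (obs t)) (hc : Measurable choice)
    (hsel : IsFinalSelection P π h obs choice) {φ : ℝ → ℝ} (hφ : Measurable φ) {C : ℝ}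
    (hφC : ∀ x, |φ x| ≤ C) :
    ((∫ ω, φ (h ω (choice ω)) ∂P : ℝ) : ℂ)
      = ∫ x, ∑ a, (φ (x.1 a) : ℂ) * (π.prob T x.2 a : ℂ)
          ∂(pastLaw P hh hobs T le_rfl : Measure ((Fin K → ℝ) × (Fin T → Fin K → ℝ))) := by
  have hX := measurable_past hh hobs T le_rfl
  have := Measure.isProbabilityMeasure_map (μ := P) hX.aemeasurable
  let f : Fin K → (Fin K → ℝ) × (Fin T → Fin K → ℝ) → ℂ := fun a x => (φ (x.1 a) : ℂ)
  let g : Fin K → Fin K → ℂ := fun a i => if i = a then 1 else 0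
  have hf : ∀ a, Measurable (f a) := fun a => by fun_prop
  have hg : ∀ a, Measurable (g a) := fun a => Measurable.of_discrete
  have hfC : ∀ a x, ‖f a x‖ ≤ C := fun a x => by
    rw [Complex.norm_real]; exact hφC _
  have hg1 : ∀ a i, ‖g a i‖ ≤ 1 := fun a i => by
    simp only [g]; split_ifs <;> simp
  have hp1 : ∀ (x : (Fin K → ℝ) × (Fin T → Fin K → ℝ)) a, ‖(π.prob T x.2 a : ℂ)‖ ≤ 1 := fun x a => by
    rw [Complex.norm_real, Real.norm_of_nonneg ((π.prob_mem T x.2).1 a)]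
    exact (mem_Icc_of_mem_stdSimplex (π.prob_mem T x.2) a).2
  have hpm : ∀ a, Measurable fun x : (Fin K → ℝ) × (Fin T → Fin K → ℝ) => (π.prob T x.2 a : ℂ) :=
    fun a => Complex.measurable_ofReal.comp
      ((measurable_pi_apply a).comp ((π.measurable_prob T).comp measurable_snd))
  -- Splitting by the selected arm lets each indicator be replaced by its conditional probability
  -- given the past.
  have e1 : ∀ ω, (φ (h ω (choice ω)) : ℂ) = ∑ a, f a (past h obs T le_rfl ω) * g a (choice ω) := by
    intro ω
    simp [f, g, past]
  rw [← integral_complex_ofReal]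
  simp only [e1]
  rw [integral_finsetSum]
  · change _ = ∫ x, ∑ a, f a x * (π.prob T x.2 a : ℂ) ∂(P.map (past h obs T le_rfl))
    rw [integral_finsetSum]
    · refine Finset.sum_congr rfl fun a _ => ?_
      rw [integral_mul_comp_condDistrib P hX hc (hf a) (hg a) (hfC a) (hg1 a)]
      refine integral_congr_ae ?_
      filter_upwards [hsel] with x hx
      rw [hx, integral_armLaw (π.prob_mem T x.2).1]
      simp [g]
    · refine fun a _ => Integrable.of_bound ((hf a).mul (hpm a)).aestronglyMeasurable C
        (Eventually.of_forall fun x => ?_)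
      rw [norm_mul]
      exact (mul_le_of_le_one_right (norm_nonneg _) (hp1 x a)).trans (hfC a x)
  · refine fun a _ => Integrable.of_bound
      (((hf a).comp hX).mul ((hg a).comp hc)).aestronglyMeasurable C (Eventually.of_forall fun x => ?_)
    rw [norm_mul]
    exact (mul_le_of_le_one_right (norm_nonneg _) (hg1 a _)).trans (hfC a _)

/-- Summing the error over all arms removes the dependence on the selected one; the bound involves
only `ν`, hence is uniform in `n` and common to both experiments. -/
lemma abs_integral_sub_integral_truncate_le {K : ℕ} {Ω : Type*} [MeasurableSpace Ω]
    {P : Measure Ω} [IsProbabilityMeasure P] {ν : Measure (Fin K → ℝ)} {h : Ω → Fin K → ℝ}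
    {choice : Ω → Fin K} (hh : Measurable h) (hc : Measurable choice)
    (hmap : P.map h = ν) (hν : Integrable (fun h : Fin K → ℝ => ∑ a, |h a|) ν) (N : ℕ) :
    |∫ ω, h ω (choice ω) ∂P - ∫ ω, truncate N (h ω (choice ω)) ∂P|
      ≤ ∫ h : Fin K → ℝ, ∑ a, |h a - truncate N (h a)| ∂ν := by
  have htm := continuous_truncate N
  have hcm := measurable_apply_choice hh hc
  have i1 := integrable_apply_choice hh hc hmap hν
  have i2 : Integrable (fun ω => truncate N (h ω (choice ω))) P :=
    Integrable.of_bound (htm.measurable.comp hcm).aestronglyMeasurable N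
      (Eventually.of_forall fun ω => abs_truncate_le N.cast_nonneg _)
  have hm : Continuous fun h : Fin K → ℝ => ∑ a, |h a - truncate N (h a)| := by fun_prop
  rw [← integral_sub i1 i2, ← hmap, integral_map hh.aemeasurable hm.aestronglyMeasurable,
    ← Real.norm_eq_abs]
  have i3 : Integrable (fun h : Fin K → ℝ => ∑ a, |h a - truncate N (h a)|) ν := by
    refine hν.mono' hm.aestronglyMeasurable (Eventually.of_forall fun h => ?_)
    rw [Real.norm_of_nonneg (Finset.sum_nonneg fun a _ => abs_nonneg _)]
    exact Finset.sum_le_sum fun a _ => abs_sub_truncate_le N.cast_nonneg _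
  rw [← hmap] at i3
  refine norm_integral_le_of_norm_le (i3.comp_measurable hh) (Eventually.of_forall fun ω => ?_)
  exact Finset.single_le_sum (f := fun a => |h ω a - truncate N (h ω a)|)
    (fun a _ => abs_nonneg _) (Finset.mem_univ (choice ω))

/-- The first term depends on the prior alone, so only the mean reward of the selected arm has to
converge. -/
lemma bayesSimpleRegret_eq {K : ℕ} [NeZero K] {Ω : Type*} [MeasurableSpace Ω] {P : Measure Ω}
    {ν : Measure (Fin K → ℝ)} {h : Ω → Fin K → ℝ} {choice : Ω → Fin K} (hh : Measurable h)
    (hc : Measurable choice) (hmap : P.map h = ν)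
    (hν : Integrable (fun h : Fin K → ℝ => ∑ a, |h a|) ν) :
    bayesSimpleRegret P h choice = ∫ h, (⨆ a, h a) ∂ν - ∫ ω, h ω (choice ω) ∂P := by
  have i1 := integrable_apply_choice hh hc hmap hν
  have hm : Measurable fun h : Fin K → ℝ => ⨆ a, h a :=
    Measurable.iSup fun a => measurable_pi_apply a
  have i2 : Integrable (fun h : Fin K → ℝ => ⨆ a, h a) ν := by
    refine hν.mono' hm.aestronglyMeasurable (Eventually.of_forall fun h => ?_)
    obtain ⟨a, ha⟩ := exists_eq_ciSup_of_finite (f := h)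
    rw [← ha]
    exact Finset.single_le_sum (f := fun a => |h a|) (fun a _ => abs_nonneg _) (Finset.mem_univ a)
  rw [bayesSimpleRegret]
  rw [← hmap] at i2 ⊢
  rw [integral_map hh.aemeasurable hm.aestronglyMeasurable]
  exact integral_sub (i2.comp_measurable hh) i1

/-- A sequence converges if it is uniformly approximated by convergent sequences. -/
lemma tendsto_of_uniform_approx {A : ℕ → ℝ} {a : ℝ} {B : ℕ → ℕ → ℝ} {β τ : ℕ → ℝ}
    (hτ : Tendsto τ atTop (𝓝 0)) (hA : ∀ N n, |A n - B N n| ≤ τ N) (ha : ∀ N, |a - β N| ≤ τ N)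
    (hB : ∀ N, Tendsto (B N) atTop (𝓝 (β N))) : Tendsto A atTop (𝓝 a) := by
  rw [Metric.tendsto_atTop]
  intro ε hε
  obtain ⟨N, hN⟩ := (hτ.eventually_lt_const (show 0 < ε / 3 by linarith)).exists
  obtain ⟨n₀, hn₀⟩ := Metric.tendsto_atTop.1 (hB N) (ε / 3) (by linarith)
  refine ⟨n₀, fun n hn => ?_⟩
  have h1 := hn₀ n hn
  rw [Real.dist_eq] at h1 ⊢
  have h2 := hA N n
  have h3 := ha N
  rw [abs_le] at h2 h3
  rw [abs_lt] at h1 ⊢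
  constructor <;> linarith

theorem mainTheorem6 {K T : ℕ} [NeZero K] (b : Fin T → ℝ) (hb : ∀ t, 0 < b t) (s : Fin K → ℝ)
    (ν : Measure (Fin K → ℝ)) [IsProbabilityMeasure ν]
    (hν : Integrable (fun h : Fin K → ℝ => ∑ a, |h a|) ν)
    (π : AdaptivePolicy K)
    (Q : ℕ → (Fin K → ℝ) → Measure (Fin K → ℝ)) (hQ : IsNoiseModel s Q)
    {Ω : ℕ → Type*} [∀ n, MeasurableSpace (Ω n)] (P : (n : ℕ) → Measure (Ω n))
    [∀ n, IsProbabilityMeasure (P n)] (D : (n : ℕ) → BatchedData K T b n (Ω n))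
    (hD : ∀ n, IsBatchedExperiment (P n) ν π Q (D n))
    {Ω' : Type*} [MeasurableSpace Ω'] (P' : Measure Ω') [IsProbabilityMeasure P']
    (E : GaussianData K T Ω') (hE : IsGaussianExperiment P' b s ν π E)
    (hπ : ∀ (t : ℕ) (ht : t ≤ T),
      P'.map (history E.G t ht) {r | ¬ ContinuousAt (π.prob t) r} = 0) :
    Tendsto (fun n => bayesSimpleRegret (P n) (D n).h (D n).choice) atTop
      (𝓝 (bayesSimpleRegret P' E.h E.choice)) := by
  have hY : Tendsto (fun n => ∫ ω, (D n).h ω ((D n).choice ω) ∂(P n)) atTop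
      (𝓝 (∫ ω, E.h ω (E.choice ω) ∂P')) := by
    refine tendsto_of_uniform_approx (tendsto_integral_sum_abs_sub_truncate hν)
      (B := fun N n => ∫ ω, truncate N ((D n).h ω ((D n).choice ω)) ∂(P n))
      (fun N n => abs_integral_sub_integral_truncate_le (hD n).measurable_h
        (hD n).measurable_choice (hD n).map_h hν N)
      (fun N => abs_integral_sub_integral_truncate_le hE.measurable_h
        hE.measurable_choice hE.map_h hν N) fun N => ?_
    have htc := continuous_truncate N
    have htN := abs_truncate_le (M := (N : ℝ)) N.cast_nonneg
    -- The integrand is bounded by `K * N` and continuous wherever `π.prob T` is, so it is an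
    -- admissible test function for the law of the full past.
    have key := tendsto_integral_of_ae_continuousAt (tendsto_pastLaw hb hQ hD hE hπ T le_rfl)
      (g := fun x => ∑ a, (truncate N (x.1 a) : ℂ) * (π.prob T x.2 a : ℂ))
      (Finset.measurable_sum _ fun a _ => Measurable.mul (by fun_prop)
        (Complex.measurable_ofReal.comp
          ((measurable_pi_apply a).comp ((π.measurable_prob T).comp measurable_snd))))
      ((ae_continuousAt_prob π hE.measurable_h hE.measurable_G le_rfl (hπ T le_rfl)).mono
        fun x hx => tendsto_finsetSum _ fun a _ => ContinuousAt.mul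
          (f := fun x : (Fin K → ℝ) × (Fin T → Fin K → ℝ) => (truncate N (x.1 a) : ℂ))
          (by fun_prop)
          (Complex.continuous_ofReal.continuousAt.comp
            ((continuous_apply a).continuousAt.comp (hx.comp continuousAt_snd))))
      (C := ∑ _a : Fin K, (N : ℝ)) fun x => (norm_sum_le _ _).trans
        (Finset.sum_le_sum fun a _ => by
          rw [norm_mul, Complex.norm_real, Complex.norm_real,
            Real.norm_of_nonneg ((π.prob_mem T x.2).1 a)]
          exact (mul_le_of_le_one_right (norm_nonneg _)
            (mem_Icc_of_mem_stdSimplex (π.prob_mem T x.2) a).2).trans (htN _))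
    rw [← integral_apply_choice hE.measurable_h hE.measurable_G hE.measurable_choice
      hE.choice_law htc.measurable htN] at key
    have e := fun n => integral_apply_choice (hD n).measurable_h (hD n).measurable_scaledMean
      (hD n).measurable_choice (hD n).choice_law htc.measurable htN
    simp only [← e] at key
    exact (Complex.continuous_re.tendsto _).comp key
  rw [bayesSimpleRegret_eq hE.measurable_h hE.measurable_choice hE.map_h hν]
  simp only [fun n => bayesSimpleRegret_eq (hD n).measurable_h (hD n).measurable_choice
    (hD n).map_h hν]
  exact hY.const_sub _
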